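/- A planar convex body is a compact convex set $K\subset\mathbb R^2$ with non-empty interior. Let $|K|$ be its area and let $\omega(K)$ be its minimal width, that is, the minimal distance between two parallel supporting lines of $K$. Let $d_{\mathcal H}$ be the Hausdorff distance of sets for the Euclidean distance, and put $$\alpha_E(K):=\min\left\{\frac{d_{\mathcal H}(K,E)}{\omega(E)}\ :\ E \text{ a (solid, non-degenerate) equilateral triangle with } \omega(E)=\omega(K)\right\};$$ the minimum is attained for every planar convex body $K$. There is a constant $c_2>0$ such that every planar convex body $K$ satisfies $$\frac{|K|}{\omega(K)^2}-\frac1{\sqrt3}\ \ge\ c_2\,\alpha_E(K),$$ and one can take $c_2=\dfrac{1}{25\sqrt5}$. The exponent $1$ of $\alpha_E$ is sharp: for every real $t<1$ and every $c>0$ there is a planar convex body $K$ with $\alpha_E(K)>0$ and $$\frac{|K|}{\omega(K)^2}-\frac1{\sqrt3}\ <\ c\,\alpha_E(K)^t .$$ -/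

import Mathlib

/-- The Euclidean plane. -/
abbrev Plane : Type := EuclideanSpace ℝ (Fin 2)

/-- The width of `K` in the direction of the unit vector `u`: the distance between the two
supporting lines of `K` orthogonal to `u`, i.e. the length of the orthogonal projection of `K`
onto a line parallel to `u` (for `K` bounded and non-empty). -/
noncomputable def directionalWidth (K : Set Plane) (u : Plane) : ℝ :=
  sSup ((fun x => inner ℝ u x) '' K) - sInf ((fun x => inner ℝ u x) '' K)

/-- The minimal width `ω(K)`: the smallest directional width. -/
noncomputable def minWidth (K : Set Plane) : ℝ :=
  sInf {w | ∃ u : Plane, ‖u‖ = 1 ∧ w = directionalWidth K u}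

/-- The area `|K|`. -/
noncomputable def area (K : Set Plane) : ℝ :=
  (MeasureTheory.volume K).toReal

/-- `E` is a (solid, non-degenerate) equilateral triangle. -/
def IsEquilateralTriangle (E : Set Plane) : Prop :=
  ∃ T : Affine.Triangle ℝ Plane, T.Equilateral ∧ E = convexHull ℝ (Set.range T.points)

/-- The values `d_H(K, E) / ω(E)`, where `E` runs over the equilateral triangles with
`ω(E) = ω(K)`. -/
def asymmetryValues (K : Set Plane) : Set ℝ :=
  {d | ∃ E : Set Plane, IsEquilateralTriangle E ∧ minWidth E = minWidth K ∧
    d = Metric.hausdorffDist K E / minWidth E}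

/-- The Hausdorff asymmetry `α_E(K)`; the theorem asserts also that this infimum is a minimum. -/
noncomputable def asymmetry (K : Set Plane) : ℝ :=
  sInf (asymmetryValues K)

/-- The deficit `|K| / ω(K)² - 1/√3` in Pál's inequality. -/
noncomputable def palDeficit (K : Set Plane) : ℝ :=
  area K / minWidth K ^ 2 - 1 / √3

/-! Let `a b c` be a triangle of maximal area in K, of area Y/2, and let x, y, z be the heights of K
beyond its sides, relative to its altitudes; put X = x + y + z. Scale so that ω(K) = 1. K contains
the triangle and three triangles erected outwards on its sides, so |K| ≥ Y(1 + X)/2. The widths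
orthogonal to the sides bound the side lengths by Y(1 + x), Y(1 + y), Y(1 + z), so the isoperimetric
inequality for triangles gives 6√3 ≤ Y(3 + X)². Eliminating Y, the deficit δ satisfies 3δ(3 + X)² ≥
√3·X(3 − X) (`deficit_lower_bound`).

This is useful only away from X = 3. Maximality gives X ≤ 3/2 (`sum_heights_le`), by comparing `a b
c` with the triangle of the three farthest points. Hence a small δ forces X = O(δ): K stays within
O(δ) of the triangle (`exists_near_triangle`), whose sides are within O(δ) of 2/√3. The Weitzenböck
defect of the sides is then O(δ²), and it is the squared distance from `c` to the apex of the
equilateral triangle over `a b` (`norm_sub_rotSixty_sq`). So an equilateral triangle of the right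
width lies within O(δ) of K. If δ is not small, any equilateral triangle of that width with vertex
`a` is good enough.

For sharpness, prolonging one side of an equilateral triangle by ε leaves the width unchanged, while
deficit and asymmetry are both of order ε. -/

/-! ### Areas of triangles -/

/-- The determinant of two plane vectors. -/
def cross (u v : Plane) : ℝ := u 0 * v 1 - u 1 * v 0

/-- Twice the signed area of the triangle `a b c`. -/
def doubleArea (a b c : Plane) : ℝ := cross (b - a) (c - a)

/-- The open triangle with vertices `a`, `b`, `c`. -/
def openTriangle (a b c : Plane) : Set Plane :=
  {x | ∃ s t : ℝ, 0 < s ∧ 0 < t ∧ s + t < 1 ∧ x = a + (s • (b - a) + t • (c - a))}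

theorem volume_standard_openTriangle :
    MeasureTheory.volume {y : Plane | 0 < y 0 ∧ 0 < y 1 ∧ y 0 + y 1 < 1} =
      ENNReal.ofReal (1 / 2) := by
  have hreg : MeasureTheory.volume
      (regionBetween (fun _ : ℝ => (0 : ℝ)) (fun x => 1 - x) (Set.Ioo 0 1)) =
      ENNReal.ofReal (1 / 2) := by
    rw [MeasureTheory.Measure.volume_eq_prod,
      volume_regionBetween_eq_integral (MeasureTheory.integrableOn_const (by simp))
        ((Continuous.integrableOn_Icc (by fun_prop)).mono_set Set.Ioo_subset_Icc_self)
        measurableSet_Ioo (fun x hx => by simpa using hx.2.le)]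
    congr 1
    rw [← MeasureTheory.integral_Ioc_eq_integral_Ioo,
      ← intervalIntegral.integral_of_le zero_le_one]
    simp only [Pi.sub_apply, sub_zero]
    rw [intervalIntegral.integral_sub (by simp) (by simp)]
    simp
    norm_num
  rw [← hreg]
  have hmp := (MeasureTheory.volume_preserving_finTwoArrow ℝ).comp
    (PiLp.volume_preserving_ofLp (Fin 2))
  rw [← hmp.measure_preimage]
  · congr 1
    ext y
    simp [regionBetween]
    constructor
    · rintro ⟨h0, h1, h2⟩
      exact ⟨⟨h0, by linarith⟩, h1, by linarith⟩
    · rintro ⟨⟨h0, -⟩, h1, h2⟩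
      exact ⟨h0, h1, by linarith⟩
  · exact (measurableSet_regionBetween measurable_const (by fun_prop)
      measurableSet_Ioo).nullMeasurableSet

/-- The linear map sending the standard basis to `u`, `v`. -/
def planeMap (u v : Plane) : Plane →ₗ[ℝ] Plane where
  toFun y := y 0 • u + y 1 • v
  map_add' x y := by simp only [PiLp.add_apply, add_smul]; abel
  map_smul' r x := by simp [mul_smul]

theorem det_planeMap (u v : Plane) : LinearMap.det (planeMap u v) = cross u v := by
  rw [← LinearMap.det_toMatrix (EuclideanSpace.basisFun (Fin 2) ℝ).toBasis, Matrix.det_fin_two]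
  simp [LinearMap.toMatrix_apply, planeMap, cross]
  ring

theorem volume_openTriangle (a b c : Plane) :
    MeasureTheory.volume (openTriangle a b c) = ENNReal.ofReal (|doubleArea a b c| / 2) := by
  have h : openTriangle a b c = (fun x => a + x) '' (planeMap (b - a) (c - a) ''
      {y : Plane | 0 < y 0 ∧ 0 < y 1 ∧ y 0 + y 1 < 1}) := by
    ext x
    simp only [openTriangle, Set.mem_ofPred_eq, Set.mem_image, exists_exists_and_eq_and]
    constructor
    · rintro ⟨s, t, hs, ht, hst, rfl⟩
      exact ⟨!₂[s, t], ⟨by simpa, by simpa, by simpa⟩, by simp [planeMap]⟩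
    · rintro ⟨y, ⟨h0, h1, h2⟩, rfl⟩
      exact ⟨y 0, y 1, h0, h1, h2, by simp [planeMap]⟩
  rw [h, Set.image_add_left, MeasureTheory.measure_preimage_add,
    MeasureTheory.Measure.addHaar_image_linearMap, det_planeMap, volume_standard_openTriangle, ← ENNReal.ofReal_mul (abs_nonneg _)]
  congr 1
  rw [doubleArea]
  ring

theorem convex_openTriangle (a b c : Plane) : Convex ℝ (openTriangle a b c) := by
  rintro _ ⟨s, t, hs, ht, hst, rfl⟩ _ ⟨s', t', hs', ht', hst', rfl⟩ α β hα hβ hαβ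
  have hpos : ∀ {x y : ℝ}, 0 < x → 0 < y → 0 < α * x + β * y := by
    intro x y hx hy
    rcases hα.eq_or_lt with rfl | hα
    · have : β = 1 := by linarith
      simpa [this] using hy
    · have := mul_pos hα hx
      have := mul_nonneg hβ hy.le
      linarith
  refine ⟨α * s + β * s', α * t + β * t', hpos hs hs', hpos ht ht', ?_, ?_⟩
  · have := hpos (sub_pos.2 hst) (sub_pos.2 hst')
    nlinarith
  · obtain rfl : β = 1 - α := by linarith
    module

theorem openTriangle_subset {K : Set Plane} (hK : Convex ℝ K) {a b c : Plane} (ha : a ∈ K)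
    (hb : b ∈ K) (hc : c ∈ K) : openTriangle a b c ⊆ K := by
  rintro _ ⟨s, t, hs, ht, hst, rfl⟩
  have h := hK.sum_mem (t := Finset.univ) (w := ![1 - s - t, s, t]) (z := ![a, b, c])
    (by intro i _; fin_cases i <;> simp <;> linarith) (by simp [Fin.sum_univ_three]; ring)
    (by intro i _; fin_cases i <;> simp [*])
  convert h using 1
  simp [Fin.sum_univ_three]
  module

theorem convexHull_subset_closure_openTriangle (a b c : Plane) :
    convexHull ℝ {a, b, c} ⊆ closure (openTriangle a b c) := by
  have key : ∀ s t : ℝ, 0 ≤ s → 0 ≤ t → s + t ≤ 1 →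
      a + (s • (b - a) + t • (c - a)) ∈ closure (openTriangle a b c) := by
    intro s t hs ht hst
    have hlim : Filter.Tendsto (fun r : ℝ => a + (((1 - r) * s + r * (1 / 3)) • (b - a) +
        ((1 - r) * t + r * (1 / 3)) • (c - a))) (nhdsWithin 0 (Set.Ioi 0))
        (nhds (a + (s • (b - a) + t • (c - a)))) := by
      have hc : Continuous (fun r : ℝ => a + (((1 - r) * s + r * (1 / 3)) • (b - a) +
        ((1 - r) * t + r * (1 / 3)) • (c - a))) := by fun_prop
      have := hc.tendsto 0
      simp only [sub_zero, one_mul, zero_mul, add_zero] at this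
      exact this.mono_left nhdsWithin_le_nhds
    refine mem_closure_of_tendsto hlim ?_
    filter_upwards [Ioo_mem_nhdsGT (zero_lt_one (α := ℝ))] with r hr
    have h1 : 0 ≤ (1 - r) * s := mul_nonneg (by linarith [hr.2]) hs
    have h2 : 0 ≤ (1 - r) * t := mul_nonneg (by linarith [hr.2]) ht
    have h3 : (1 - r) * (s + t) ≤ (1 - r) * 1 :=
      mul_le_mul_of_nonneg_left hst (by linarith [hr.2])
    exact ⟨_, _, by linarith [hr.1], by linarith [hr.1], by linarith [hr.1], rfl⟩
  refine convexHull_min ?_ (convex_openTriangle a b c).closure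
  rintro x (rfl | rfl | rfl)
  · simpa using key 0 0 le_rfl le_rfl (by norm_num)
  · simpa using key 1 0 zero_le_one le_rfl (by norm_num)
  · simpa using key 0 1 le_rfl zero_le_one (by norm_num)

/-- The frontier of a convex set is null, so passing to the closed triangle costs no area. -/
theorem volume_convexHull_triangle_le (a b c : Plane) :
    MeasureTheory.volume (convexHull ℝ {a, b, c}) ≤
      ENNReal.ofReal (|doubleArea a b c| / 2) := by
  refine (MeasureTheory.measure_mono (convexHull_subset_closure_openTriangle a b c)).trans ?_
  rw [closure_eq_self_union_frontier]
  refine (MeasureTheory.measure_union_le _ _).trans ?_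
  rw [(convex_openTriangle a b c).addHaar_frontier MeasureTheory.volume, volume_openTriangle, add_zero]

/-- The sign pattern is what separates the triangle erected on `a b` from the triangle itself and
from those erected on the other two sides. -/
theorem openTriangle_signs {a b c p x : Plane} (hD : 0 < doubleArea a b c)
    (hab : doubleArea a b p ≤ 0) (hbc : 0 ≤ doubleArea b c p) (hca : 0 ≤ doubleArea c a p)
    (hx : x ∈ openTriangle a b p) :
    doubleArea a b x ≤ 0 ∧ 0 < doubleArea b c x ∧ 0 < doubleArea c a x := by
  obtain ⟨s, t, hs, ht, hst, rfl⟩ := hx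
  have e1 : doubleArea a b (a + (s • (b - a) + t • (p - a))) = t * doubleArea a b p := by
    simp [doubleArea, cross]; ring
  have e2 : doubleArea b c (a + (s • (b - a) + t • (p - a))) =
      (1 - s - t) * doubleArea a b c + t * doubleArea b c p := by
    simp [doubleArea, cross]; ring
  have e3 : doubleArea c a (a + (s • (b - a) + t • (p - a))) =
      s * doubleArea a b c + t * doubleArea c a p := by
    simp [doubleArea, cross]; ring
  rw [e1, e2, e3]
  exact ⟨mul_nonpos_of_nonneg_of_nonpos ht.le hab,
    add_pos_of_pos_of_nonneg (mul_pos (by linarith) hD) (mul_nonneg ht.le hbc),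
    add_pos_of_pos_of_nonneg (mul_pos hs hD) (mul_nonneg ht.le hca)⟩

theorem openTriangle_pos {a b c x : Plane} (hD : 0 < doubleArea a b c)
    (hx : x ∈ openTriangle a b c) :
    0 < doubleArea a b x ∧ 0 < doubleArea b c x ∧ 0 < doubleArea c a x := by
  obtain ⟨s, t, hs, ht, hst, rfl⟩ := hx
  have e1 : doubleArea a b (a + (s • (b - a) + t • (c - a))) = t * doubleArea a b c := by
    simp [doubleArea, cross]; ring
  have e2 : doubleArea b c (a + (s • (b - a) + t • (c - a))) =
      (1 - s - t) * doubleArea a b c := by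
    simp [doubleArea, cross]; ring
  have e3 : doubleArea c a (a + (s • (b - a) + t • (c - a))) = s * doubleArea a b c := by
    simp [doubleArea, cross]; ring
  rw [e1, e2, e3]
  exact ⟨mul_pos ht hD, mul_pos (by linarith) hD, mul_pos hs hD⟩

theorem doubleArea_rotate (a b c : Plane) : doubleArea b c a = doubleArea a b c := by
  simp [doubleArea, cross]; ring

/-- A convex set contains a triangle together with the three triangles erected outwards on its
sides. -/
theorem le_area_of_outer_points {K : Set Plane} (hK : Convex ℝ K)
    (hfin : MeasureTheory.volume K ≠ ⊤) {a b c p q r : Plane} (ha : a ∈ K) (hb : b ∈ K)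
    (hc : c ∈ K) (hp : p ∈ K) (hq : q ∈ K) (hr : r ∈ K) (hD : 0 < doubleArea a b c)
    (hp1 : doubleArea b c p ≤ 0) (hp2 : 0 ≤ doubleArea c a p) (hp3 : 0 ≤ doubleArea a b p)
    (hq1 : doubleArea c a q ≤ 0) (hq2 : 0 ≤ doubleArea a b q) (hq3 : 0 ≤ doubleArea b c q)
    (hr1 : doubleArea a b r ≤ 0) (hr2 : 0 ≤ doubleArea b c r) (hr3 : 0 ≤ doubleArea c a r) :
    (doubleArea a b c - doubleArea b c p - doubleArea c a q - doubleArea a b r) / 2 ≤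
      area K := by
  have hD' : 0 < doubleArea b c a := by rwa [doubleArea_rotate]
  have hD'' : 0 < doubleArea c a b := by rwa [doubleArea_rotate, doubleArea_rotate]
  have nm : ∀ u v w, MeasureTheory.NullMeasurableSet (openTriangle u v w) :=
    fun u v w => (convex_openTriangle u v w).nullMeasurableSet MeasureTheory.volume
  have d1 : Disjoint (openTriangle a b c) (openTriangle b c p) :=
    Set.disjoint_left.2 fun x h h' => by
      linarith [(openTriangle_pos hD h).2.1, (openTriangle_signs hD' hp1 hp2 hp3 h').1]
  have d2 : Disjoint (openTriangle a b c ∪ openTriangle b c p) (openTriangle c a q) :=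
    Set.disjoint_left.2 fun x h h' => by
      have h' := openTriangle_signs hD'' hq1 hq2 hq3 h'
      rcases h with h | h
      · linarith [(openTriangle_pos hD h).2.2]
      · linarith [(openTriangle_signs hD' hp1 hp2 hp3 h).2.1]
  have d3 : Disjoint (openTriangle a b c ∪ openTriangle b c p ∪ openTriangle c a q)
      (openTriangle a b r) :=
    Set.disjoint_left.2 fun x h h' => by
      have h' := openTriangle_signs hD hr1 hr2 hr3 h'
      rcases h with (h | h) | h
      · linarith [(openTriangle_pos hD h).1]
      · linarith [(openTriangle_signs hD' hp1 hp2 hp3 h).2.2]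
      · linarith [(openTriangle_signs hD'' hq1 hq2 hq3 h).2.1]
  have hsub : openTriangle a b c ∪ openTriangle b c p ∪ openTriangle c a q ∪ openTriangle a b r
      ⊆ K :=
    Set.union_subset (Set.union_subset (Set.union_subset (openTriangle_subset hK ha hb hc)
      (openTriangle_subset hK hb hc hp)) (openTriangle_subset hK hc ha hq))
      (openTriangle_subset hK ha hb hr)
  have hle := MeasureTheory.measure_mono (μ := MeasureTheory.volume) hsub
  rw [MeasureTheory.measure_union₀ (nm _ _ _) d3.aedisjoint,
    MeasureTheory.measure_union₀ (nm _ _ _) d2.aedisjoint,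
    MeasureTheory.measure_union₀ (nm _ _ _) d1.aedisjoint, volume_openTriangle,
    volume_openTriangle, volume_openTriangle, volume_openTriangle, abs_of_pos hD,
    abs_of_nonpos hp1, abs_of_nonpos hq1, abs_of_nonpos hr1,
    ← ENNReal.ofReal_add (by linarith) (by linarith),
    ← ENNReal.ofReal_add (by linarith) (by linarith),
    ← ENNReal.ofReal_add (by linarith) (by linarith), ENNReal.ofReal_le_iff_le_toReal hfin] at hle
  rw [area]
  linarith

/-! ### Widths of compact sets -/

theorem bddAbove_inner_image {K : Set Plane} (hK : IsCompact K) (u : Plane) :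
    BddAbove ((fun x => inner ℝ u x) '' K) :=
  (hK.image (by fun_prop)).bddAbove

theorem bddBelow_inner_image {K : Set Plane} (hK : IsCompact K) (u : Plane) :
    BddBelow ((fun x => inner ℝ u x) '' K) :=
  (hK.image (by fun_prop)).bddBelow

theorem inner_sub_le_directionalWidth {K : Set Plane} (hK : IsCompact K) (u : Plane)
    {x y : Plane} (hx : x ∈ K) (hy : y ∈ K) : inner ℝ u (x - y) ≤ directionalWidth K u := by
  rw [inner_sub_right]
  exact sub_le_sub (le_csSup (bddAbove_inner_image hK u) ⟨x, hx, rfl⟩)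
    (csInf_le (bddBelow_inner_image hK u) ⟨y, hy, rfl⟩)

theorem directionalWidth_le {K : Set Plane} (hne : K.Nonempty) {u : Plane} {c : ℝ}
    (h : ∀ x ∈ K, ∀ y ∈ K, inner ℝ u (x - y) ≤ c) : directionalWidth K u ≤ c := by
  rw [directionalWidth, sub_le_iff_le_add]
  refine csSup_le (hne.image _) ?_
  rintro _ ⟨x, hx, rfl⟩
  rw [← sub_le_iff_le_add']
  refine le_csInf (hne.image _) ?_
  rintro _ ⟨y, hy, rfl⟩
  have := h x hx y hy
  rw [inner_sub_right] at this
  simp only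
  linarith

theorem directionalWidth_nonneg {K : Set Plane} (hK : IsCompact K) (hne : K.Nonempty)
    (u : Plane) : 0 ≤ directionalWidth K u := by
  obtain ⟨x, hx⟩ := hne
  simpa using inner_sub_le_directionalWidth hK u hx hx

theorem minWidth_le_directionalWidth {K : Set Plane} (hK : IsCompact K) (hne : K.Nonempty)
    {u : Plane} (hu : ‖u‖ = 1) : minWidth K ≤ directionalWidth K u := by
  refine csInf_le ⟨0, ?_⟩ ⟨u, hu, rfl⟩
  rintro _ ⟨v, -, rfl⟩
  exact directionalWidth_nonneg hK hne v

theorem le_minWidth {K : Set Plane} {c : ℝ}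
    (h : ∀ u : Plane, ‖u‖ = 1 → c ≤ directionalWidth K u) : c ≤ minWidth K := by
  refine le_csInf ⟨_, EuclideanSpace.single 0 1, by simp, rfl⟩ ?_
  rintro _ ⟨u, hu, rfl⟩
  exact h u hu

theorem minWidth_pos {K : Set Plane} (hK : IsCompact K) (hint : (interior K).Nonempty) :
    0 < minWidth K := by
  obtain ⟨o, ho⟩ := hint
  obtain ⟨ε, hε, hball⟩ := Metric.isOpen_iff.1 isOpen_interior o ho
  refine lt_of_lt_of_le (half_pos hε) (le_minWidth fun u hu => ?_)
  have hmem : o + (ε / 2) • u ∈ K := interior_subset (hball (by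
    simp [norm_smul, hu, abs_of_pos hε]; linarith))
  have := inner_sub_le_directionalWidth hK u hmem (interior_subset ho)
  simpa [real_inner_smul_right, hu] using this

theorem plane_norm_sq (v : Plane) : ‖v‖ ^ 2 = v 0 ^ 2 + v 1 ^ 2 := by
  simp [EuclideanSpace.norm_sq_eq, Fin.sum_univ_two]

theorem plane_inner (u v : Plane) : inner ℝ u v = u 0 * v 0 + u 1 * v 1 := by
  simp [PiLp.inner_apply, Fin.sum_univ_two]; ring

/-- The width of `K` orthogonally to the line `b c`. -/
theorem minWidth_mul_dist_le {K : Set Plane} (hK : IsCompact K) (hne : K.Nonempty)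
    {b c : Plane} (hbc : b ≠ c) {M : ℝ}
    (hM : ∀ x ∈ K, ∀ y ∈ K, doubleArea b c x - doubleArea b c y ≤ M) :
    minWidth K * dist b c ≤ M := by
  have hd : 0 < dist b c := dist_pos.2 hbc
  set u : Plane := (dist b c)⁻¹ • !₂[b 1 - c 1, c 0 - b 0] with hu
  have hn : ‖(!₂[b 1 - c 1, c 0 - b 0] : Plane)‖ = dist b c := by
    rw [dist_eq_norm, ← sq_eq_sq₀ (norm_nonneg _) (norm_nonneg _), plane_norm_sq, plane_norm_sq]
    simp; ring
  have hu1 : ‖u‖ = 1 := by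
    rw [hu, norm_smul, hn, Real.norm_of_nonneg (inv_nonneg.2 hd.le), inv_mul_cancel₀ hd.ne']
  have h1 := minWidth_le_directionalWidth hK hne hu1
  have h2 : directionalWidth K u ≤ M / dist b c := by
    refine directionalWidth_le hne fun x hx y hy => ?_
    have : inner ℝ u (x - y) = (doubleArea b c x - doubleArea b c y) / dist b c := by
      rw [hu, real_inner_smul_left, plane_inner]
      simp [doubleArea, cross]
      field_simp
      ring
    rw [this]
    exact div_le_div_of_nonneg_right (hM x hx y hy) hd.le
  exact (le_div_iff₀ hd).1 (h1.trans h2)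

/-! ### The inscribed triangle of maximal area -/

theorem exists_doubleArea_pos {K : Set Plane} (hint : (interior K).Nonempty) :
    ∃ a ∈ K, ∃ b ∈ K, ∃ c ∈ K, 0 < doubleArea a b c := by
  obtain ⟨o, ho⟩ := hint
  obtain ⟨ε, hε, hball⟩ := Metric.isOpen_iff.1 isOpen_interior o ho
  have hmem : ∀ i : Fin 2, o + EuclideanSpace.single i (ε / 2) ∈ K := fun i =>
    interior_subset (hball (by simp [abs_of_pos hε]; linarith))
  refine ⟨o, interior_subset ho, _, hmem 0, _, hmem 1, ?_⟩
  simp [doubleArea, cross]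
  positivity

/-- A triangle of maximal area in a compact set. -/
theorem exists_max_doubleArea {K : Set Plane} (hK : IsCompact K)
    (hint : (interior K).Nonempty) :
    ∃ a ∈ K, ∃ b ∈ K, ∃ c ∈ K, 0 < doubleArea a b c ∧
      ∀ x ∈ K, ∀ y ∈ K, ∀ z ∈ K, doubleArea x y z ≤ doubleArea a b c := by
  obtain ⟨a₀, ha₀, b₀, hb₀, c₀, hc₀, hpos⟩ := exists_doubleArea_pos hint
  have hc : Continuous fun p : Plane × Plane × Plane => doubleArea p.1 p.2.1 p.2.2 := by
    unfold doubleArea cross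
    simp only [PiLp.sub_apply]
    fun_prop
  obtain ⟨⟨a, b, c⟩, ⟨ha, hb, hcK⟩, hmax⟩ := (hK.prod (hK.prod hK)).exists_isMaxOn
    ⟨(a₀, b₀, c₀), ha₀, hb₀, hc₀⟩ hc.continuousOn
  refine ⟨a, ha, b, hb, c, hcK, ?_, ?_⟩
  · exact hpos.trans_le (hmax (show (a₀, b₀, c₀) ∈ _ from ⟨ha₀, hb₀, hc₀⟩))
  · intro x hx y hy z hz
    exact hmax (show (x, y, z) ∈ _ from ⟨hx, hy, hz⟩)

/-- The matrix is I − L with L a weighted graph Laplacian. As det L = 0, det(I − L) = 1 − tr L +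
e₂(L), and e₂(L) is the sum of the nine rooted spanning tree products supplied as hints, all
nonnegative. -/
theorem one_sub_le_det_stochastic {s₁ t₁ s₂ t₂ s₃ t₃ : ℝ} (hs₁ : 0 ≤ s₁) (ht₁ : 0 ≤ t₁)
    (hs₂ : 0 ≤ s₂) (ht₂ : 0 ≤ t₂) (hs₃ : 0 ≤ s₃) (ht₃ : 0 ≤ t₃) :
    1 - (s₁ + t₁ + s₂ + t₂ + s₃ + t₃) ≤
      (1 - s₁ - t₁) * ((1 - s₂ - t₂) * (1 - s₃ - t₃) - s₂ * t₃) -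
      s₁ * (t₂ * (1 - s₃ - t₃) - s₂ * s₃) + t₁ * (t₂ * t₃ - (1 - s₂ - t₂) * s₃) := by
  nlinarith [mul_nonneg hs₁ hs₂, mul_nonneg ht₁ hs₂, mul_nonneg ht₁ ht₂, mul_nonneg hs₂ hs₃,
    mul_nonneg ht₂ hs₃, mul_nonneg ht₂ ht₃, mul_nonneg hs₃ hs₁, mul_nonneg ht₃ hs₁,
    mul_nonneg ht₃ ht₁]

theorem doubleArea_add (a b c x : Plane) :
    doubleArea b c x + doubleArea c a x + doubleArea a b x = doubleArea a b c := by
  simp [doubleArea, cross]; ring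

/-- The ratio of the two signed areas is the determinant of the barycentric coordinates of `p`, `q`,
`r` relative to `a b c`; denominators are cleared. -/
theorem doubleArea_mul_sq (a b c p q r : Plane) :
    doubleArea p q r * doubleArea a b c ^ 2 =
      doubleArea b c p * (doubleArea c a q * doubleArea a b r - doubleArea a b q * doubleArea c a r)
      - doubleArea c a p *
        (doubleArea b c q * doubleArea a b r - doubleArea a b q * doubleArea b c r)
      + doubleArea a b p *
        (doubleArea b c q * doubleArea c a r - doubleArea c a q * doubleArea b c r) := by
  simp [doubleArea, cross]; ring

/-- If the triangle `p q r` is not larger than `a b c`, then the points `p`, `q`, `r` cannot all be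
far beyond the sides of `a b c`. -/
theorem sum_heights_le {a b c p q r : Plane} (hD : 0 < doubleArea a b c)
    (hmax : doubleArea p q r ≤ doubleArea a b c)
    (hp2 : doubleArea c a p ≤ doubleArea a b c) (hp3 : doubleArea a b p ≤ doubleArea a b c)
    (hq1 : doubleArea b c q ≤ doubleArea a b c) (hq3 : doubleArea a b q ≤ doubleArea a b c)
    (hr1 : doubleArea b c r ≤ doubleArea a b c) (hr2 : doubleArea c a r ≤ doubleArea a b c) :
    -doubleArea b c p - doubleArea c a q - doubleArea a b r ≤ 3 / 2 * doubleArea a b c := by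
  have e := doubleArea_mul_sq a b c p q r
  have ep := doubleArea_add a b c p
  have eq := doubleArea_add a b c q
  have er := doubleArea_add a b c r
  set Y := doubleArea a b c
  have half : ∀ {m : ℝ}, m ≤ Y → 0 ≤ (1 - m / Y) / 2 := by
    intro m hm
    have : m / Y ≤ 1 := (div_le_one hD).2 hm
    linarith
  -- With M the barycentric matrix of `p q r` and J the all-ones matrix, this uses (J − M)/2: the
  -- homothety of ratio −1/2 about the centroid sends `p`, `q`, `r` into the triangle `a b c`, so
  -- the entries become nonnegative.
  have key := one_sub_le_det_stochastic (half hp2) (half hp3) (half hq3) (half hq1)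
    (half hr1) (half hr2)
  have hp1 : doubleArea b c p = Y - doubleArea c a p - doubleArea a b p := by linarith
  have hq2 : doubleArea c a q = Y - doubleArea a b q - doubleArea b c q := by linarith
  have hr3 : doubleArea a b r = Y - doubleArea b c r - doubleArea c a r := by linarith
  rw [hp1, hq2, hr3] at e ⊢
  generalize doubleArea c a p = p2 at *
  generalize doubleArea a b p = p3 at *
  generalize doubleArea b c q = q1 at *
  generalize doubleArea a b q = q3 at *
  generalize doubleArea b c r = r1 at *
  generalize doubleArea c a r = r2 at *
  obtain ⟨p2, rfl⟩ : ∃ t, p2 = t * Y := ⟨p2 / Y, by field_simp⟩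
  obtain ⟨p3, rfl⟩ : ∃ t, p3 = t * Y := ⟨p3 / Y, by field_simp⟩
  obtain ⟨q1, rfl⟩ : ∃ t, q1 = t * Y := ⟨q1 / Y, by field_simp⟩
  obtain ⟨q3, rfl⟩ : ∃ t, q3 = t * Y := ⟨q3 / Y, by field_simp⟩
  obtain ⟨r1, rfl⟩ : ∃ t, r1 = t * Y := ⟨r1 / Y, by field_simp⟩
  obtain ⟨r2, rfl⟩ : ∃ t, r2 = t * Y := ⟨r2 / Y, by field_simp⟩
  simp only [mul_div_cancel_right₀ _ hD.ne'] at key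
  have e' : doubleArea p q r = Y * ((1 - p2 - p3) * ((1 - q3 - q1) * (1 - r1 - r2) - q3 * r2)
      - p2 * (q1 * (1 - r1 - r2) - q3 * r1) + p3 * (q1 * r2 - (1 - q3 - q1) * r1)) := by
    have h2 : Y ^ 2 ≠ 0 := by positivity
    apply mul_right_cancel₀ h2
    rw [e]
    ring
  rw [e'] at hmax
  have h1 : (1 - p2 - p3) * ((1 - q3 - q1) * (1 - r1 - r2) - q3 * r2)
      - p2 * (q1 * (1 - r1 - r2) - q3 * r1) + p3 * (q1 * r2 - (1 - q3 - q1) * r1) ≤ 1 := by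
    by_contra! hcon
    nlinarith
  -- The homothety divides the determinant by 4, so with S the sum on the left, `key` reads 1 − (3 −
  -- S/2) ≤ det M / 4 ≤ 1/4.
  have h2 : p2 + p3 + q1 + q3 + r1 + r2 ≤ 9 / 2 := by
    nlinarith [key, h1]
  nlinarith

/-- The triangle of maximal area inside a planar convex body, with the heights `x`, `y`, `z` of the
body above its sides, relative to the altitudes of the triangle. -/
theorem exists_extremal_triangle {K : Set Plane} (hconv : Convex ℝ K) (hK : IsCompact K)
    (hint : (interior K).Nonempty) :
    ∃ a ∈ K, ∃ b ∈ K, ∃ c ∈ K, 0 < doubleArea a b c ∧ ∃ x y z : ℝ,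
      0 ≤ x ∧ 0 ≤ y ∧ 0 ≤ z ∧ x + y + z ≤ 3 / 2 ∧
      (∀ w ∈ K, (-x * doubleArea a b c ≤ doubleArea b c w ∧
          doubleArea b c w ≤ doubleArea a b c) ∧
        (-y * doubleArea a b c ≤ doubleArea c a w ∧ doubleArea c a w ≤ doubleArea a b c) ∧
        (-z * doubleArea a b c ≤ doubleArea a b w ∧ doubleArea a b w ≤ doubleArea a b c)) ∧
      doubleArea a b c * (1 + (x + y + z)) / 2 ≤ area K ∧
      minWidth K * dist b c ≤ doubleArea a b c * (1 + x) ∧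
      minWidth K * dist c a ≤ doubleArea a b c * (1 + y) ∧
      minWidth K * dist a b ≤ doubleArea a b c * (1 + z) := by
  obtain ⟨a, ha, b, hb, c, hc, hD, hmax⟩ := exists_max_doubleArea hK hint
  refine ⟨a, ha, b, hb, c, hc, hD, ?_⟩
  have hne : K.Nonempty := ⟨a, ha⟩
  have hcont : ∀ u v : Plane, ContinuousOn (doubleArea u v) K := fun u v => by
    unfold doubleArea cross
    simp only [PiLp.sub_apply]
    fun_prop
  have hself : ∀ u v : Plane, doubleArea u v u = 0 := fun u v => by simp [doubleArea, cross]
  have upA : ∀ w ∈ K, doubleArea b c w ≤ doubleArea a b c := fun w hw => hmax _ hb _ hc _ hw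
  have upB : ∀ w ∈ K, doubleArea c a w ≤ doubleArea a b c := fun w hw => hmax _ hc _ ha _ hw
  have upC : ∀ w ∈ K, doubleArea a b w ≤ doubleArea a b c := fun w hw => hmax _ ha _ hb _ hw
  obtain ⟨p, hp, hpmin⟩ := hK.exists_isMinOn hne (hcont b c)
  obtain ⟨q, hq, hqmin⟩ := hK.exists_isMinOn hne (hcont c a)
  obtain ⟨r, hr, hrmin⟩ := hK.exists_isMinOn hne (hcont a b)
  have hpmin : ∀ w ∈ K, doubleArea b c p ≤ doubleArea b c w := fun w hw => hpmin hw
  have hqmin : ∀ w ∈ K, doubleArea c a q ≤ doubleArea c a w := fun w hw => hqmin hw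
  have hrmin : ∀ w ∈ K, doubleArea a b r ≤ doubleArea a b w := fun w hw => hrmin hw
  have hp0 : doubleArea b c p ≤ 0 := hself b c ▸ hpmin b hb
  have hq0 : doubleArea c a q ≤ 0 := hself c a ▸ hqmin c hc
  have hr0 : doubleArea a b r ≤ 0 := hself a b ▸ hrmin a ha
  have hsum := sum_heights_le hD (hmax _ hp _ hq _ hr) (upB p hp) (upC p hp) (upA q hq) (upC q hq)
    (upA r hr) (upB r hr)
  have harea := le_area_of_outer_points hconv hK.measure_lt_top.ne ha hb hc hp hq hr hD
    hp0 (by linarith [doubleArea_add a b c p, upC p hp])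
    (by linarith [doubleArea_add a b c p, upB p hp])
    hq0 (by linarith [doubleArea_add a b c q, upA q hq])
    (by linarith [doubleArea_add a b c q, upC q hq])
    hr0 (by linarith [doubleArea_add a b c r, upB r hr])
    (by linarith [doubleArea_add a b c r, upA r hr])
  have hbc : b ≠ c := by rintro rfl; simp [doubleArea, cross] at hD; linarith
  have hca : c ≠ a := by rintro rfl; simp [doubleArea, cross] at hD
  have hab : a ≠ b := by rintro rfl; simp [doubleArea, cross] at hD
  have wA := minWidth_mul_dist_le hK hne hbc (M := doubleArea a b c - doubleArea b c p)
    fun v hv w hw => by linarith [upA v hv, hpmin w hw]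
  have wB := minWidth_mul_dist_le hK hne hca (M := doubleArea a b c - doubleArea c a q)
    fun v hv w hw => by linarith [upB v hv, hqmin w hw]
  have wC := minWidth_mul_dist_le hK hne hab (M := doubleArea a b c - doubleArea a b r)
    fun v hv w hw => by linarith [upC v hv, hrmin w hw]
  set Y := doubleArea a b c
  obtain ⟨x, hx⟩ : ∃ x, doubleArea b c p = -x * Y :=
    ⟨-(doubleArea b c p / Y), by field_simp⟩
  obtain ⟨y, hy⟩ : ∃ y, doubleArea c a q = -y * Y :=
    ⟨-(doubleArea c a q / Y), by field_simp⟩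
  obtain ⟨z, hz⟩ : ∃ z, doubleArea a b r = -z * Y :=
    ⟨-(doubleArea a b r / Y), by field_simp⟩
  rw [hx] at hp0 harea hsum wA hpmin
  rw [hy] at hq0 harea hsum wB hqmin
  rw [hz] at hr0 harea hsum wC hrmin
  refine ⟨x, y, z, by nlinarith, by nlinarith, by nlinarith, by nlinarith, fun w hw =>
    ⟨⟨hpmin w hw, upA w hw⟩, ⟨hqmin w hw, upB w hw⟩, hrmin w hw, upC w hw⟩, by linarith,
    by linarith, by linarith, by linarith⟩

/-! ### Inequalities between sides, heights and deficit -/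

theorem mul_le_add_cube {u v w : ℝ} (hu : 0 ≤ u) (hv : 0 ≤ v) (hw : 0 ≤ w) :
    27 * (u * v * w) ≤ (u + v + w) ^ 3 := by
  nlinarith [mul_nonneg hu (sq_nonneg (v - w)), mul_nonneg hv (sq_nonneg (u - w)),
    mul_nonneg hw (sq_nonneg (u - v)), mul_nonneg (add_nonneg (add_nonneg hu hv) hw)
      (add_nonneg (add_nonneg (sq_nonneg (u - v)) (sq_nonneg (v - w))) (sq_nonneg (u - w)))]

/-- The isoperimetric inequality for a triangle with sides `b₁`, `b₂`, `b₃` and area `Y / 2`. -/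
theorem triangle_isoperimetric {b₁ b₂ b₃ Y : ℝ} (h₁ : b₁ ≤ b₂ + b₃) (h₂ : b₂ ≤ b₃ + b₁)
    (h₃ : b₃ ≤ b₁ + b₂)
    (heron : 4 * Y ^ 2 = 2 * (b₁ ^ 2 * b₂ ^ 2 + b₂ ^ 2 * b₃ ^ 2 + b₃ ^ 2 * b₁ ^ 2) -
      (b₁ ^ 4 + b₂ ^ 4 + b₃ ^ 4)) :
    6 * √3 * Y ≤ (b₁ + b₂ + b₃) ^ 2 := by
  have h := mul_le_add_cube (sub_nonneg.2 h₁) (sub_nonneg.2 h₂) (sub_nonneg.2 h₃)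
  have hP : 0 ≤ b₁ + b₂ + b₃ := by linarith
  -- By Heron, 4Y² is the perimeter P times the three factors bounded by AM-GM, so 27·4Y² ≤ P⁴.
  have h' := mul_le_mul_of_nonneg_left h hP
  have h3 : √3 ^ 2 = 3 := Real.sq_sqrt (by norm_num)
  refine le_of_sq_le_sq ?_ (sq_nonneg _)
  have e : (6 * √3 * Y) ^ 2 = 27 * (4 * Y ^ 2) := by
    rw [mul_pow, mul_pow, h3]; ring
  rw [e, heron]
  nlinarith

theorem sqrt_three_sq : √3 ^ 2 = 3 := Real.sq_sqrt (by norm_num)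

theorem lt_sqrt_three : 1.732 < √3 := Real.lt_sqrt_of_sq_lt (by norm_num)

theorem sqrt_three_lt : √3 < 1.7321 := (Real.sqrt_lt' (by norm_num)).2 (by norm_num)

theorem lt_sqrt_five : 2.236 < √5 := Real.lt_sqrt_of_sq_lt (by norm_num)

theorem one_div_sqrt_three : 1 / √3 = √3 / 3 := by
  rw [div_eq_div_iff (by positivity) (by norm_num)]
  linarith [sqrt_three_sq]

section Estimates

variable {b₁ b₂ b₃ Y x y z X δ : ℝ}

theorem le_mul_three_add_sq (hY : 0 < Y) (hX : x + y + z = X) (hP : 0 ≤ b₁ + b₂ + b₃)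
    (hiso : 6 * √3 * Y ≤ (b₁ + b₂ + b₃) ^ 2)
    (h₁ : b₁ ≤ Y * (1 + x)) (h₂ : b₂ ≤ Y * (1 + y)) (h₃ : b₃ ≤ Y * (1 + z)) :
    6 * √3 ≤ Y * (3 + X) ^ 2 := by
  have h : (b₁ + b₂ + b₃) ^ 2 ≤ (Y * (3 + X)) ^ 2 := by
    refine pow_le_pow_left₀ hP ?_ 2
    rw [← hX]
    linarith
  have h' : Y * (6 * √3) ≤ Y * (Y * (3 + X) ^ 2) := by linarith
  exact le_of_mul_le_mul_left h' hY

/-- The deficit in Pál's inequality controls the relative heights of the body over its maximal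
triangle. -/
theorem deficit_lower_bound (hX : 0 ≤ X) (hY : 6 * √3 ≤ Y * (3 + X) ^ 2)
    (hA : Y * (1 + X) / 2 ≤ √3 / 3 + δ) :
    √3 * (X * (3 - X)) ≤ 3 * δ * (3 + X) ^ 2 := by
  have e1 := mul_le_mul_of_nonneg_right hY (by linarith : 0 ≤ 1 + X)
  have e2 := mul_le_mul_of_nonneg_right hA (sq_nonneg (3 + X))
  linarith

/-- On 0.34 < X ≤ 3/2 the hypothesis `h` would force δ > 0.045. Below 0.34 one has 3 − X ≥ 2.66 and
3 + X ≤ 3.34, and 3·3.34²/(1.732·2.66) < 7.3. -/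
theorem height_sum_small (hX : 0 ≤ X) (hX' : X ≤ 3 / 2) (hδ : δ < 0.045)
    (h : √3 * (X * (3 - X)) ≤ 3 * δ * (3 + X) ^ 2) : 0 ≤ δ ∧ X ≤ 7.3 * δ ∧ X ≤ 0.34 := by
  have hXX : 0 ≤ X * (3 - X) := mul_nonneg hX (by linarith)
  have hk : 1.732 * (X * (3 - X)) ≤ 3 * δ * (3 + X) ^ 2 :=
    (mul_le_mul_of_nonneg_right lt_sqrt_three.le hXX).trans h
  have hsq : 0 < (3 + X) ^ 2 := by positivity
  have h0 : 0 ≤ δ := by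
    by_contra! hneg
    nlinarith
  have h34 : X ≤ 0.34 := by
    by_contra! hgt
    nlinarith
  refine ⟨h0, ?_, h34⟩
  have h1 : (3 + X) ^ 2 ≤ 3.34 ^ 2 := pow_le_pow_left₀ (by linarith) (by linarith) 2
  have h2 : 3 * δ * (3 + X) ^ 2 ≤ 3 * δ * 3.34 ^ 2 :=
    mul_le_mul_of_nonneg_left h1 (by linarith)
  have h3 : X * 2.66 ≤ X * (3 - X) := mul_le_mul_of_nonneg_left (by linarith) hX
  linarith

/-- In the regime of a small deficit, the maximal triangle is nearly equilateral. -/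
theorem side_bounds_of_small_deficit (hY : 0 < Y) (hx : 0 ≤ x) (hy : 0 ≤ y) (hz : 0 ≤ z)
    (hXe : x + y + z = X) (hb₁ : 0 ≤ b₁) (hb₂ : 0 ≤ b₂) (hb₃ : 0 ≤ b₃)
    (hiso : 6 * √3 * Y ≤ (b₁ + b₂ + b₃) ^ 2)
    (h₁ : b₁ ≤ Y * (1 + x)) (h₂ : b₂ ≤ Y * (1 + y)) (h₃ : b₃ ≤ Y * (1 + z))
    (hA : Y * (1 + X) / 2 ≤ √3 / 3 + δ) (hXδ : X ≤ 7.3 * δ) :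
    (b₁ ≤ 2 * (√3 / 3) + 2 * δ ∧ b₂ ≤ 2 * (√3 / 3) + 2 * δ ∧ b₃ ≤ 2 * (√3 / 3) + 2 * δ) ∧
      2 * (√3 / 3) - 12.5 * δ ≤ b₁ ∧ 2 * (√3 / 3) - 12.5 * δ ≤ b₂ ∧
      2 * (√3 / 3) - 12.5 * δ ≤ b₃ := by
  have hX : 0 ≤ X := by linarith
  have hYX := le_mul_three_add_sq hY hXe (by positivity) hiso h₁ h₂ h₃
  have hk : 0 < √3 := by positivity
  have hYx : Y * x ≤ Y * X := mul_le_mul_of_nonneg_left (by linarith) hY.le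
  have hYy : Y * y ≤ Y * X := mul_le_mul_of_nonneg_left (by linarith) hY.le
  have hYz : Y * z ≤ Y * X := mul_le_mul_of_nonneg_left (by linarith) hY.le
  have hYXe : Y * X = Y * x + Y * y + Y * z := by rw [← hXe]; ring
  have hYx0 : 0 ≤ Y * x := by positivity
  have hYy0 : 0 ≤ Y * y := by positivity
  have hYz0 : 0 ≤ Y * z := by positivity
  have u₁ : b₁ ≤ 2 * (√3 / 3) + 2 * δ := by linarith
  have u₂ : b₂ ≤ 2 * (√3 / 3) + 2 * δ := by linarith
  have u₃ : b₃ ≤ 2 * (√3 / 3) + 2 * δ := by linarith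
  have hP : 6 * √3 ≤ (b₁ + b₂ + b₃) * (3 + X) := by
    refine le_of_sq_le_sq ?_ (by positivity)
    have e1 := mul_le_mul_of_nonneg_right hiso (sq_nonneg (3 + X))
    have e2 := mul_le_mul_of_nonneg_left hYX (by positivity : 0 ≤ 6 * √3)
    linarith
  have hP' : 2 * √3 - 2 * √3 * X / 3 ≤ b₁ + b₂ + b₃ := by
    have hX3 : 0 < 3 + X := by linarith
    refine le_of_mul_le_mul_right (le_trans ?_ hP) hX3
    have := mul_nonneg hk.le (sq_nonneg X)
    linarith
  have hkX : √3 * X ≤ 1.7321 * (7.3 * δ) :=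
    mul_le_mul sqrt_three_lt.le hXδ hX (by norm_num)
  -- The perimeter bound minus two upper side bounds loses 2√3X/3 + 4δ, which is less than 12.5δ.
  have l₁ : 2 * (√3 / 3) - 12.5 * δ ≤ b₁ := by linarith
  have l₂ : 2 * (√3 / 3) - 12.5 * δ ≤ b₂ := by linarith
  have l₃ : 2 * (√3 / 3) - 12.5 * δ ≤ b₃ := by linarith
  exact ⟨⟨u₁, u₂, u₃⟩, l₁, l₂, l₃⟩

theorem small_deficit_estimates (hY : 0 < Y) (hx : 0 ≤ x) (hy : 0 ≤ y) (hz : 0 ≤ z)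
    (hXe : x + y + z = X) (hX' : X ≤ 3 / 2) (hb₁ : 0 ≤ b₁) (hb₂ : 0 ≤ b₂) (hb₃ : 0 ≤ b₃)
    (hiso : 6 * √3 * Y ≤ (b₁ + b₂ + b₃) ^ 2)
    (heron : 4 * Y ^ 2 = 2 * (b₁ ^ 2 * b₂ ^ 2 + b₂ ^ 2 * b₃ ^ 2 + b₃ ^ 2 * b₁ ^ 2) -
      (b₁ ^ 4 + b₂ ^ 4 + b₃ ^ 4))
    (h₁ : b₁ ≤ Y * (1 + x)) (h₂ : b₂ ≤ Y * (1 + y)) (h₃ : b₃ ≤ Y * (1 + z))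
    (hA : Y * (1 + X) / 2 ≤ √3 / 3 + δ) (hδ : δ < 0.045) :
    0 ≤ δ ∧ X * (2 * (√3 / 3 + δ)) ≤ 9.1 * δ ∧ |b₃ - 2 * (√3 / 3)| ≤ 12.5 * δ ∧
      (b₁ ^ 2 + b₂ ^ 2 + b₃ ^ 2) / 2 - √3 * Y ≤ (25 * δ) ^ 2 := by
  have hX : 0 ≤ X := by rw [← hXe]; positivity
  have hYX := le_mul_three_add_sq hY hXe (by positivity) hiso h₁ h₂ h₃
  obtain ⟨h0, hXδ, hX34⟩ := height_sum_small hX hX' hδ (deficit_lower_bound hX hYX hA)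
  obtain ⟨⟨u₁, u₂, u₃⟩, l₁, l₂, l₃⟩ := side_bounds_of_small_deficit hY hx hy hz hXe hb₁ hb₂ hb₃
    hiso h₁ h₂ h₃ hA hXδ
  have hk1 := lt_sqrt_three
  have hk2 := sqrt_three_lt
  have h3 := sqrt_three_sq
  have hk : 0 < √3 := by positivity
  refine ⟨h0, ?_, abs_le.2 ⟨by linarith, by linarith⟩, ?_⟩
  · have : X * (2 * (√3 / 3 + δ)) ≤ (7.3 * δ) * 1.2448 :=
      mul_le_mul hXδ (by linarith) (by linarith) (by linarith)
    linarith
  · have diff : ∀ {s t : ℝ}, 0 ≤ s → 0 ≤ t → s ≤ 2 * (√3 / 3) + 2 * δ →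
        t ≤ 2 * (√3 / 3) + 2 * δ → 2 * (√3 / 3) - 12.5 * δ ≤ s → 2 * (√3 / 3) - 12.5 * δ ≤ t →
        (s ^ 2 - t ^ 2) ^ 2 ≤ (36.12 * δ) ^ 2 := by
      intro s t hs ht us ut ls lt
      have : |s ^ 2 - t ^ 2| ≤ |36.12 * δ| := by
        rw [sq_sub_sq, abs_mul, abs_of_nonneg (by linarith : 0 ≤ s + t),
          abs_of_nonneg (by linarith : 0 ≤ 36.12 * δ)]
        have : |s - t| ≤ 14.5 * δ := abs_le.2 ⟨by linarith, by linarith⟩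
        calc (s + t) * |s - t| ≤ 2.49 * (14.5 * δ) :=
              mul_le_mul (by linarith) this (abs_nonneg _) (by norm_num)
          _ ≤ 36.12 * δ := by linarith
      exact sq_le_sq.2 this
    have d₁ := diff hb₁ hb₂ u₁ u₂ l₁ l₂
    have d₂ := diff hb₂ hb₃ u₂ u₃ l₂ l₃
    have d₃ := diff hb₃ hb₁ u₃ u₁ l₃ l₁
    -- `w` is the defect in Weitzenböck's inequality. By Heron, multiplying by the conjugate factor
    -- gives a sum of squares of differences of the bᵢ², so `w` is of second order in δ; finally
    -- (3/2)·36.12²/3.22 < 25².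
    set w := (b₁ ^ 2 + b₂ ^ 2 + b₃ ^ 2) / 2 - √3 * Y with hw
    have e : w * (w + 2 * (√3 * Y)) =
        ((b₁ ^ 2 - b₂ ^ 2) ^ 2 + (b₂ ^ 2 - b₃ ^ 2) ^ 2 + (b₃ ^ 2 - b₁ ^ 2) ^ 2) / 2 := by
      have : w * (w + 2 * (√3 * Y)) =
          ((b₁ ^ 2 + b₂ ^ 2 + b₃ ^ 2) / 2) ^ 2 - √3 ^ 2 * Y ^ 2 := by rw [hw]; ring
      rw [this, h3]
      linarith
    have hYlow : 3.22 ≤ 2 * (√3 * Y) := by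
      have h1 : Y * (3 + X) ^ 2 ≤ Y * 3.34 ^ 2 :=
        mul_le_mul_of_nonneg_left (pow_le_pow_left₀ (by linarith) (by linarith) 2) hY.le
      have h2 : √3 * (6 * √3) ≤ √3 * (Y * 3.34 ^ 2) :=
        mul_le_mul_of_nonneg_left (hYX.trans h1) hk.le
      nlinarith
    by_contra! hcon
    have hw0 : 0 ≤ w := (sq_nonneg _).trans hcon.le
    have : w * 3.22 ≤ w * (w + 2 * (√3 * Y)) := mul_le_mul_of_nonneg_left (by linarith) hw0
    nlinarith [sq_nonneg δ]

/-- The threshold 0.045 is large enough that 4/√3 ≤ (25√5 − 4)δ. -/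
theorem large_deficit_estimate (hδ : 0.045 ≤ δ) :
    2 * (√3 / 3) ≤ 4 * (√3 / 3 + δ) ∧ 4 * (√3 / 3 + δ) ≤ 25 * √5 * δ := by
  have h := mul_le_mul_of_nonneg_right lt_sqrt_five.le (by linarith : 0 ≤ δ)
  have hk : 0 < √3 := by positivity
  have := sqrt_three_lt
  constructor <;> linarith

end Estimates

/-! ### Equilateral triangles and their width -/

/-- Rotation of the plane by sixty degrees. -/
noncomputable def rotSixty (v : Plane) : Plane :=
  !₂[v 0 / 2 - √3 / 2 * v 1, √3 / 2 * v 0 + v 1 / 2]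

/-- The solid equilateral triangle with vertex `c` and edge `v`. -/
noncomputable def eqTriangle (c v : Plane) : Set Plane :=
  convexHull ℝ {c, c + v, c + rotSixty v}

theorem norm_rotSixty (v : Plane) : ‖rotSixty v‖ = ‖v‖ := by
  rw [← sq_eq_sq₀ (norm_nonneg _) (norm_nonneg _), plane_norm_sq, plane_norm_sq]
  simp [rotSixty]
  linear_combination (v 0 ^ 2 + v 1 ^ 2) / 4 * sqrt_three_sq

theorem norm_rotSixty_sub (v : Plane) : ‖rotSixty v - v‖ = ‖v‖ := by
  rw [← sq_eq_sq₀ (norm_nonneg _) (norm_nonneg _), plane_norm_sq, plane_norm_sq]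
  simp [rotSixty]
  linear_combination (v 0 ^ 2 + v 1 ^ 2) / 4 * sqrt_three_sq

theorem rotSixty_sub (v w : Plane) : rotSixty (v - w) = rotSixty v - rotSixty w := by
  ext i; fin_cases i <;> simp [rotSixty] <;> ring

theorem cross_rotSixty (v : Plane) : cross v (rotSixty v) = √3 / 2 * ‖v‖ ^ 2 := by
  rw [plane_norm_sq]
  simp [cross, rotSixty]
  ring

/-- The distance of `w` to the apex of the equilateral triangle over `v`. -/
theorem norm_sub_rotSixty_sq (v w : Plane) :
    ‖w - rotSixty v‖ ^ 2 =
      (‖v‖ ^ 2 + ‖w‖ ^ 2 + ‖w - v‖ ^ 2) / 2 - √3 * cross v w := by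
  simp only [plane_norm_sq]
  simp [cross, rotSixty]
  linear_combination (v 0 ^ 2 + v 1 ^ 2) / 4 * sqrt_three_sq

theorem inner_sq_add_cross_sq (v w : Plane) :
    inner ℝ v w ^ 2 + cross v w ^ 2 = ‖v‖ ^ 2 * ‖w‖ ^ 2 := by
  rw [plane_norm_sq, plane_norm_sq, plane_inner, cross]
  ring

/-- The two alternatives are the two orientations: the side lengths fix the inner product, hence the
cross product up to sign. -/
theorem eq_rotSixty_or {v w : Plane} (h₁ : ‖w‖ = ‖v‖) (h₂ : ‖w - v‖ = ‖v‖) :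
    w = rotSixty v ∨ v = rotSixty w := by
  have hin : inner ℝ v w = ‖v‖ ^ 2 / 2 := by
    have e : ‖w - v‖ ^ 2 = ‖w‖ ^ 2 - 2 * inner ℝ v w + ‖v‖ ^ 2 := by
      rw [plane_norm_sq, plane_norm_sq, plane_norm_sq, plane_inner]; simp; ring
    rw [h₂, h₁] at e
    linarith
  have hcr : (cross v w - √3 / 2 * ‖v‖ ^ 2) * (cross v w + √3 / 2 * ‖v‖ ^ 2) = 0 := by
    have e := inner_sq_add_cross_sq v w
    rw [hin, h₁] at e
    linear_combination e - ‖v‖ ^ 4 / 4 * sqrt_three_sq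
  rcases mul_eq_zero.1 hcr with h | h
  · left
    have e := norm_sub_rotSixty_sq v w
    rw [h₁, h₂, sub_eq_zero.1 h] at e
    have : ‖w - rotSixty v‖ ^ 2 = 0 := by
      rw [e]; linear_combination -‖v‖ ^ 2 / 2 * sqrt_three_sq
    exact sub_eq_zero.1 (norm_eq_zero.1 (pow_eq_zero_iff two_ne_zero |>.1 this))
  · right
    have e := norm_sub_rotSixty_sq w v
    have hc : cross w v = √3 / 2 * ‖v‖ ^ 2 := by
      have : cross w v = -cross v w := by simp [cross]; ring
      linarith
    rw [h₁, norm_sub_rev v w, h₂, hc] at e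
    have : ‖v - rotSixty w‖ ^ 2 = 0 := by
      rw [e]; linear_combination -‖v‖ ^ 2 / 2 * sqrt_three_sq
    exact sub_eq_zero.1 (norm_eq_zero.1 (pow_eq_zero_iff two_ne_zero |>.1 this))

theorem range_fin_three {α : Type*} (f : Fin 3 → α) : Set.range f = {f 0, f 1, f 2} := by
  ext x
  simp [Fin.exists_fin_succ, eq_comm]

theorem isEquilateralTriangle_iff {E : Set Plane} :
    IsEquilateralTriangle E ↔ ∃ c v : Plane, v ≠ 0 ∧ E = eqTriangle c v := by
  constructor
  · rintro ⟨T, hT, rfl⟩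
    rw [Affine.Triangle.equilateral_iff_dist_eq_and_dist_eq (i₁ := 0) (i₂ := 1) (i₃ := 2)
      (by decide) (by decide) (by decide)] at hT
    have h01 : T.points 0 ≠ T.points 1 := T.independent.injective.ne (by decide)
    have h02 : T.points 0 ≠ T.points 2 := T.independent.injective.ne (by decide)
    rw [range_fin_three]
    have h₁ : ‖T.points 2 - T.points 0‖ = ‖T.points 1 - T.points 0‖ := by
      rw [← dist_eq_norm, ← dist_eq_norm, dist_comm, ← hT.1, dist_comm]
    have h₂ : ‖(T.points 2 - T.points 0) - (T.points 1 - T.points 0)‖ =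
        ‖T.points 1 - T.points 0‖ := by
      rw [sub_sub_sub_cancel_right, ← dist_eq_norm, ← dist_eq_norm, dist_comm, ← hT.2, dist_comm]
    rcases eq_rotSixty_or h₁ h₂ with h | h
    · refine ⟨T.points 0, T.points 1 - T.points 0, sub_ne_zero.2 h01.symm, ?_⟩
      rw [eqTriangle, ← h]
      simp
    · refine ⟨T.points 0, T.points 2 - T.points 0, sub_ne_zero.2 h02.symm, ?_⟩
      rw [eqTriangle, ← h, add_sub_cancel, add_sub_cancel, Set.pair_comm (T.points 2)]
  · rintro ⟨c, v, hv, rfl⟩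
    have hnv : 0 < ‖v‖ := norm_pos_iff.2 hv
    have hli : LinearIndependent ℝ ![v, rotSixty v] := by
      rw [LinearIndependent.pair_iff]
      intro s t hst
      have hcr : 0 < cross v (rotSixty v) := by rw [cross_rotSixty]; positivity
      have e0 := congrArg (fun w : Plane => w 0) hst
      have e1 := congrArg (fun w : Plane => w 1) hst
      simp only [PiLp.add_apply, PiLp.smul_apply, smul_eq_mul, PiLp.zero_apply] at e0 e1
      constructor
      · have : s * cross v (rotSixty v) = 0 := by
          rw [cross]; linear_combination rotSixty v 1 * e0 - rotSixty v 0 * e1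
        exact (mul_eq_zero.1 this).resolve_right hcr.ne'
      · have : t * cross v (rotSixty v) = 0 := by
          rw [cross]; linear_combination v 0 * e1 - v 1 * e0
        exact (mul_eq_zero.1 this).resolve_right hcr.ne'
    have hai : AffineIndependent ℝ ![c, c + v, c + rotSixty v] := by
      rw [affineIndependent_iff_linearIndependent_vsub ℝ _ (0 : Fin 3)]
      refine (linearIndependent_equiv' (finSuccAboveEquiv (0 : Fin 3)) ?_).1 hli
      ext i
      fin_cases i <;> simp [finSuccAboveEquiv]
    refine ⟨⟨_, hai⟩, ?_, ?_⟩
    · rw [Affine.Triangle.equilateral_iff_dist_eq_and_dist_eq (i₁ := 0) (i₂ := 1) (i₃ := 2)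
        (by decide) (by decide) (by decide)]
      simp [norm_rotSixty, dist_eq_norm]
      rw [norm_sub_rev, norm_rotSixty_sub]
    · rw [range_fin_three]
      simp [eqTriangle]

theorem isCompact_convexHull_triple (a b c : Plane) : IsCompact (convexHull ℝ {a, b, c}) :=
  (Set.toFinite _).isCompact_convexHull (𝕜 := ℝ)

theorem mem_convexHull_triple (a b c : Plane) :
    a ∈ convexHull ℝ {a, b, c} ∧ b ∈ convexHull ℝ {a, b, c} ∧ c ∈ convexHull ℝ {a, b, c} :=
  ⟨subset_convexHull ℝ _ (by simp), subset_convexHull ℝ _ (by simp),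
    subset_convexHull ℝ _ (by simp)⟩

theorem doubleArea_mem_of_mem_convexHull {a b c x : Plane} (hD : 0 ≤ doubleArea a b c)
    (hx : x ∈ convexHull ℝ {a, b, c}) :
    0 ≤ doubleArea a b x ∧ doubleArea a b x ≤ doubleArea a b c := by
  have hconv : Convex ℝ {x | 0 ≤ doubleArea a b x ∧ doubleArea a b x ≤ doubleArea a b c} := by
    rintro x ⟨hx1, hx2⟩ y ⟨hy1, hy2⟩ α β hα hβ hαβ
    have e : doubleArea a b (α • x + β • y) =
        α * doubleArea a b x + β * doubleArea a b y := by
      obtain rfl : β = 1 - α := by linarith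
      simp [doubleArea, cross]; ring
    simp only [Set.mem_ofPred_eq, e]
    constructor
    · positivity
    · obtain rfl : β = 1 - α := by linarith
      nlinarith
  refine convexHull_min ?_ hconv hx
  rintro y (rfl | rfl | rfl)
  · simpa [doubleArea, cross] using hD
  · have : doubleArea a y y = 0 := by simp [doubleArea, cross]; ring
    simpa [this] using hD
  · exact ⟨hD, le_rfl⟩

theorem minWidth_convexHull_triple_le {a b c : Plane} (hab : a ≠ b)
    (hD : 0 ≤ doubleArea a b c) :
    minWidth (convexHull ℝ {a, b, c}) * dist a b ≤ doubleArea a b c :=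
  minWidth_mul_dist_le (isCompact_convexHull_triple a b c) ⟨a, (mem_convexHull_triple a b c).1⟩
    hab fun _ hx _ hy => by
      linarith [(doubleArea_mem_of_mem_convexHull hD hx).2,
        (doubleArea_mem_of_mem_convexHull hD hy).1]

/-- The projections s, t of two edges satisfy s² − st + t² = 3‖v‖²/4. This is at most (t − s)² if st
≤ 0 and at most max(s², t²) otherwise, and |s|, |t|, |t − s| are all bounded by the width. -/
theorem le_directionalWidth_of_eqTriangle_subset {K : Set Plane} (hK : IsCompact K)
    {c v u : Plane} (hsub : eqTriangle c v ⊆ K) (hu : ‖u‖ = 1) :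
    √3 / 2 * ‖v‖ ≤ directionalWidth K u := by
  obtain ⟨h0, h1, h2⟩ := mem_convexHull_triple c (c + v) (c + rotSixty v)
  have a1 := inner_sub_le_directionalWidth hK u (hsub h1) (hsub h0)
  have a2 := inner_sub_le_directionalWidth hK u (hsub h0) (hsub h1)
  have b1 := inner_sub_le_directionalWidth hK u (hsub h2) (hsub h0)
  have b2 := inner_sub_le_directionalWidth hK u (hsub h0) (hsub h2)
  have c1 := inner_sub_le_directionalWidth hK u (hsub h2) (hsub h1)
  have c2 := inner_sub_le_directionalWidth hK u (hsub h1) (hsub h2)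
  have hM := directionalWidth_nonneg hK ⟨c, hsub h0⟩ u
  set M := directionalWidth K u
  have hframe : inner ℝ u v ^ 2 - inner ℝ u v * inner ℝ u (rotSixty v) +
      inner ℝ u (rotSixty v) ^ 2 = (√3 / 2 * ‖v‖) ^ 2 := by
    have hu2 : u 0 ^ 2 + u 1 ^ 2 = 1 := by rw [← plane_norm_sq, hu]; norm_num
    rw [mul_pow, plane_norm_sq, plane_inner, plane_inner]
    simp only [rotSixty]
    simp
    linear_combination (u 0 * v 1 - u 1 * v 0) ^ 2 / 4 * sqrt_three_sq +
      3 / 4 * (v 0 ^ 2 + v 1 ^ 2) * hu2 - (v 0 ^ 2 + v 1 ^ 2) / 4 * sqrt_three_sq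
  simp only [inner_sub_right, inner_add_right] at a1 a2 b1 b2 c1 c2
  set s := inner ℝ u v
  set t := inner ℝ u (rotSixty v)
  refine le_of_sq_le_sq ?_ hM
  rw [← hframe]
  have hs : s ^ 2 ≤ M ^ 2 := sq_le_sq' (by linarith) (by linarith)
  have ht : t ^ 2 ≤ M ^ 2 := sq_le_sq' (by linarith) (by linarith)
  have hst : (t - s) ^ 2 ≤ M ^ 2 := sq_le_sq' (by linarith) (by linarith)
  rcases le_total (s * t) 0 with h | h
  · nlinarith
  · rcases le_total (s ^ 2) (t ^ 2) with h' | h'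
    · have : s ^ 2 ≤ s * t := by
        have h2 : (s ^ 2) ^ 2 ≤ (s * t) ^ 2 := by rw [mul_pow, sq (s ^ 2)]; gcongr
        exact le_of_sq_le_sq h2 h
      linarith
    · have : t ^ 2 ≤ s * t := by
        have h2 : (t ^ 2) ^ 2 ≤ (s * t) ^ 2 := by rw [mul_pow, sq (t ^ 2)]; gcongr
        exact le_of_sq_le_sq h2 h
      linarith

theorem minWidth_eqTriangle (c : Plane) {v : Plane} (hv : v ≠ 0) :
    minWidth (eqTriangle c v) = √3 / 2 * ‖v‖ := by
  have hnv : 0 < ‖v‖ := norm_pos_iff.2 hv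
  refine le_antisymm ?_ (le_minWidth fun u hu => le_directionalWidth_of_eqTriangle_subset
    (isCompact_convexHull_triple _ _ _) subset_rfl hu)
  have hD : doubleArea c (c + v) (c + rotSixty v) = √3 / 2 * ‖v‖ ^ 2 := by
    rw [doubleArea, add_sub_cancel_left, add_sub_cancel_left, cross_rotSixty]
  have h := minWidth_convexHull_triple_le (a := c) (b := c + v) (c := c + rotSixty v)
    (by simpa using hv) (by rw [hD]; positivity)
  rw [hD, dist_self_add_right] at h
  refine le_of_mul_le_mul_right (h.trans_eq ?_) hnv
  ring

/-! ### Hausdorff distance to equilateral triangles, and attainment of the minimum -/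

theorem exists_dist_le_of_mem_convexHull {a b c a' b' c' x : Plane} {ρ : ℝ} (ha : dist a a' ≤ ρ)
    (hb : dist b b' ≤ ρ) (hc : dist c c' ≤ ρ) (hx : x ∈ convexHull ℝ {a, b, c}) :
    ∃ y ∈ convexHull ℝ {a', b', c'}, dist x y ≤ ρ := by
  have hρ : 0 ≤ ρ := dist_nonneg.trans ha
  obtain ⟨ha', hb', hc'⟩ := mem_convexHull_triple a' b' c'
  have h : convexHull ℝ {a, b, c} ⊆ Metric.cthickening ρ (convexHull ℝ {a', b', c'}) := by
    refine convexHull_min ?_ ((convex_convexHull ℝ _).cthickening ρ)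
    rintro y (rfl | rfl | rfl)
    · exact Metric.mem_cthickening_of_dist_le _ _ _ _ ha' ha
    · exact Metric.mem_cthickening_of_dist_le _ _ _ _ hb' hb
    · exact Metric.mem_cthickening_of_dist_le _ _ _ _ hc' hc
  have hx' := h hx
  rw [(isCompact_convexHull_triple a' b' c').cthickening_eq_biUnion_closedBall hρ] at hx'
  simpa using hx'

theorem hausdorffDist_eqTriangle_le (c v c' v' : Plane) :
    Metric.hausdorffDist (eqTriangle c v) (eqTriangle c' v') ≤ ‖c - c'‖ + ‖v - v'‖ := by
  have main : ∀ c v c' v' : Plane, ∀ x ∈ eqTriangle c v,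
      ∃ y ∈ eqTriangle c' v', dist x y ≤ ‖c - c'‖ + ‖v - v'‖ := by
    intro c v c' v' x hx
    refine exists_dist_le_of_mem_convexHull ?_ ?_ ?_ hx
    · rw [dist_eq_norm]; linarith [norm_nonneg (v - v')]
    · rw [dist_eq_norm, add_sub_add_comm]; exact norm_add_le _ _
    · rw [dist_eq_norm, add_sub_add_comm, ← rotSixty_sub, ← norm_rotSixty (v - v')]
      exact norm_add_le _ _
  refine Metric.hausdorffDist_le_of_mem_dist (by positivity) (main c v c' v') ?_
  intro x hx
  rw [norm_sub_rev c, norm_sub_rev v]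
  exact main c' v' c v x hx

theorem eqTriangle_nonempty (c v : Plane) : (eqTriangle c v).Nonempty :=
  ⟨c, (mem_convexHull_triple _ _ _).1⟩

theorem isCompact_eqTriangle (c v : Plane) : IsCompact (eqTriangle c v) :=
  isCompact_convexHull_triple _ _ _

theorem mem_asymmetryValues_iff {K : Set Plane} (hW : 0 < minWidth K) {d : ℝ} :
    d ∈ asymmetryValues K ↔ ∃ c v : Plane, ‖v‖ = 2 * (√3 / 3) * minWidth K ∧
      d = Metric.hausdorffDist K (eqTriangle c v) / minWidth K := by
  have hk : √3 * √3 = 3 := by rw [← sq, sqrt_three_sq]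
  constructor
  · rintro ⟨E, hE, hEW, rfl⟩
    obtain ⟨c, v, hv, rfl⟩ := isEquilateralTriangle_iff.1 hE
    refine ⟨c, v, ?_, by rw [hEW]⟩
    rw [← hEW, minWidth_eqTriangle c hv]
    linear_combination -‖v‖ / 3 * hk
  · rintro ⟨c, v, hv, rfl⟩
    have hv0 : v ≠ 0 := by
      rw [← norm_pos_iff, hv]; positivity
    have hEW : minWidth (eqTriangle c v) = minWidth K := by
      rw [minWidth_eqTriangle c hv0, hv]
      linear_combination minWidth K / 3 * hk
    exact ⟨_, isEquilateralTriangle_iff.2 ⟨c, v, hv0, rfl⟩, hEW, by rw [hEW]⟩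

theorem continuous_hausdorffDist_eqTriangle {K : Set Plane} (hK : IsCompact K)
    (hne : K.Nonempty) :
    Continuous fun p : Plane × Plane => Metric.hausdorffDist K (eqTriangle p.1 p.2) := by
  have hfin : ∀ p : Plane × Plane, Metric.hausdorffEDist K (eqTriangle p.1 p.2) ≠ ⊤ := fun p =>
    Metric.hausdorffEDist_ne_top_of_nonempty_of_bounded hne (eqTriangle_nonempty _ _)
      hK.isBounded (isCompact_eqTriangle _ _).isBounded
  have hle : ∀ p q : Plane × Plane, Metric.hausdorffDist K (eqTriangle p.1 p.2) ≤
      Metric.hausdorffDist K (eqTriangle q.1 q.2) + 2 * dist p q := by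
    intro p q
    have h1 := Metric.hausdorffDist_triangle (hfin q) (u := eqTriangle p.1 p.2)
    have h2 := hausdorffDist_eqTriangle_le q.1 q.2 p.1 p.2
    have h3 : ‖q.1 - p.1‖ ≤ dist p q := by
      rw [← dist_eq_norm, dist_comm p q]; exact le_max_left _ _
    have h4 : ‖q.2 - p.2‖ ≤ dist p q := by
      rw [← dist_eq_norm, dist_comm p q]; exact le_max_right _ _
    linarith
  refine (LipschitzWith.of_dist_le_mul (K := 2) fun p q => ?_).continuous
  rw [Real.dist_eq, abs_sub_le_iff]
  have := hle p q
  have h' := hle q p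
  rw [dist_comm q p] at h'
  constructor <;> simp <;> linarith

/-- The infimum defining the asymmetry is attained. -/
theorem isLeast_asymmetry {K : Set Plane} (hK : IsCompact K) (hne : K.Nonempty)
    (hW : 0 < minWidth K) : IsLeast (asymmetryValues K) (asymmetry K) := by
  obtain ⟨o, ho⟩ := hne
  set ℓ := 2 * (√3 / 3) * minWidth K with hℓ
  have hℓ0 : 0 < ℓ := by positivity
  set v₀ : Plane := EuclideanSpace.single 0 ℓ
  have hv₀ : ‖v₀‖ = ℓ := by simp [v₀, abs_of_pos hℓ0]
  set f : Plane × Plane → ℝ := fun p => Metric.hausdorffDist K (eqTriangle p.1 p.2)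
  -- A triangle with its vertex farther than R from `o` is already farther from K than the one at
  -- `(o, v₀)`, so compactness applies to the remaining parameters.
  set R := f (o, v₀) + Metric.diam K with hR
  have hR0 : 0 ≤ R := add_nonneg Metric.hausdorffDist_nonneg Metric.diam_nonneg
  obtain ⟨⟨c, v⟩, ⟨-, hv⟩, hmin⟩ := ((isCompact_closedBall o R).prod
    (isCompact_sphere (0 : Plane) ℓ)).exists_isMinOn
    ⟨(o, v₀), by simpa using hR0, by simpa using hv₀⟩
    (continuous_hausdorffDist_eqTriangle hK ⟨o, ho⟩).continuousOn
  have hv : ‖v‖ = ℓ := by simpa using hv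
  have hmin : ∀ c' ∈ Metric.closedBall o R, ∀ v' : Plane, ‖v'‖ = ℓ → f (c, v) ≤ f (c', v') :=
    fun c' hc' v' hv' => hmin (show (c', v') ∈ _ from ⟨hc', by simpa using hv'⟩)
  have hglob : ∀ c' v' : Plane, ‖v'‖ = ℓ → f (c, v) ≤ f (c', v') := by
    intro c' v' hv'
    rcases le_or_gt (dist c' o) R with h | h
    · exact hmin c' h v' hv'
    · have h1 := hmin o (by simpa using hR0) v₀ hv₀
      obtain ⟨y, hy, hyd⟩ := hK.exists_infDist_eq_dist ⟨o, ho⟩ c'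
      have h2 : Metric.infDist c' K ≤ Metric.hausdorffDist (eqTriangle c' v') K :=
        Metric.infDist_le_hausdorffDist_of_mem (mem_convexHull_triple _ _ _).1
          (Metric.hausdorffEDist_ne_top_of_nonempty_of_bounded (eqTriangle_nonempty _ _) ⟨o, ho⟩
            (isCompact_eqTriangle _ _).isBounded hK.isBounded)
      rw [Metric.hausdorffDist_comm, hyd] at h2
      have h3 : dist y o ≤ Metric.diam K := Metric.dist_le_diam_of_mem hK.isBounded hy ho
      have h4 := dist_triangle c' y o
      change f (c, v) ≤ Metric.hausdorffDist K (eqTriangle c' v')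
      linarith
  have hleast : IsLeast (asymmetryValues K) (f (c, v) / minWidth K) := by
    refine ⟨(mem_asymmetryValues_iff hW).2 ⟨c, v, hv, rfl⟩, ?_⟩
    rintro d hd
    obtain ⟨c', v', hv', rfl⟩ := (mem_asymmetryValues_iff hW).1 hd
    exact div_le_div_of_nonneg_right (hglob c' v' hv') hW.le
  rwa [asymmetry, hleast.csInf_eq]

theorem asymmetry_le {K : Set Plane} (hK : IsCompact K) (hne : K.Nonempty)
    (hW : 0 < minWidth K) {c v : Plane} (hv : ‖v‖ = 2 * (√3 / 3) * minWidth K) :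
    asymmetry K ≤ Metric.hausdorffDist K (eqTriangle c v) / minWidth K :=
  (isLeast_asymmetry hK hne hW).2 ((mem_asymmetryValues_iff hW).2 ⟨c, v, hv, rfl⟩)

/-! ### Distance from the body to its maximal triangle -/

theorem doubleArea_smul_eq (a b c w : Plane) :
    doubleArea a b c • w =
      doubleArea b c w • a + doubleArea c a w • b + doubleArea a b w • c := by
  ext i
  fin_cases i <;> simp [doubleArea, cross] <;> ring

theorem eq_barycentric {a b c : Plane} (hD : doubleArea a b c ≠ 0) (w : Plane) :
    w = (doubleArea b c w / doubleArea a b c) • a + (doubleArea c a w / doubleArea a b c) • b +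
      (doubleArea a b w / doubleArea a b c) • c := by
  have h : w = (doubleArea a b c)⁻¹ • (doubleArea a b c • w) := (inv_smul_smul₀ hD w).symm
  rw [doubleArea_smul_eq a b c w] at h
  refine h.trans ?_
  module

theorem mem_convexHull_of_weights {a b c : Plane} {r s t : ℝ} (hr : 0 ≤ r) (hs : 0 ≤ s)
    (ht : 0 ≤ t) (h : r + s + t = 1) : r • a + s • b + t • c ∈ convexHull ℝ {a, b, c} := by
  obtain ⟨ha, hb, hc⟩ := mem_convexHull_triple a b c
  have h := (convex_convexHull ℝ {a, b, c}).sum_mem (t := Finset.univ) (w := ![r, s, t])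
    (z := ![a, b, c]) (by intro i _; fin_cases i <;> simpa)
    (by simpa [Fin.sum_univ_three] using h)
    (by intro i _; fin_cases i <;> assumption)
  simpa [Fin.sum_univ_three] using h

/-- Moving the negative weight at `a` over to `b` displaces `w` parallel to `a b` onto the side `b
c`; the weight at `b` stays nonnegative because the weight at `c` is at most 1. -/
theorem exists_near_triangle_of_beyond_side {a b c w : Plane} (hD : 0 < doubleArea a b c)
    (h₁ : doubleArea b c w ≤ 0) (h₂ : doubleArea c a w ≤ doubleArea a b c)
    (h₃ : doubleArea a b w ≤ doubleArea a b c) :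
    ∃ y ∈ convexHull ℝ {a, b, c},
      dist w y ≤ -doubleArea b c w / doubleArea a b c * dist a b := by
  have hsum := doubleArea_add a b c w
  have hw := eq_barycentric hD.ne' w
  set Y := doubleArea a b c
  set n₁ := doubleArea b c w
  set n₂ := doubleArea c a w
  set n₃ := doubleArea a b w
  refine ⟨(0 : ℝ) • a + ((n₁ + n₂) / Y) • b + (n₃ / Y) • c,
    mem_convexHull_of_weights le_rfl (div_nonneg (by linarith) hD.le)
      (div_nonneg (by linarith) hD.le) (by field_simp; linarith), ?_⟩
  have e : w - ((0 : ℝ) • a + ((n₁ + n₂) / Y) • b + (n₃ / Y) • c) = (n₁ / Y) • (a - b) := by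
    rw [sub_eq_iff_eq_add]
    refine hw.trans ?_
    module
  rw [dist_eq_norm, e, norm_smul, dist_eq_norm, Real.norm_eq_abs,
    abs_of_nonpos (div_nonpos_of_nonpos_of_nonneg h₁ hD.le), neg_div]

theorem convexHull_triple_rotate (a b c : Plane) :
    convexHull ℝ {b, c, a} = convexHull ℝ ({a, b, c} : Set Plane) := by
  rw [Set.insert_comm a b, Set.pair_comm a c]

/-- A point of the plane close to a triangle in barycentric coordinates is close to it. -/
theorem exists_near_triangle {a b c w : Plane} {x y z M : ℝ} (hD : 0 < doubleArea a b c)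
    (hx : 0 ≤ x) (hy : 0 ≤ y) (hz : 0 ≤ z)
    (h₁ : -x * doubleArea a b c ≤ doubleArea b c w ∧ doubleArea b c w ≤ doubleArea a b c)
    (h₂ : -y * doubleArea a b c ≤ doubleArea c a w ∧ doubleArea c a w ≤ doubleArea a b c)
    (h₃ : -z * doubleArea a b c ≤ doubleArea a b w ∧ doubleArea a b w ≤ doubleArea a b c)
    (hM₁ : dist b c ≤ M) (hM₂ : dist c a ≤ M) (hM₃ : dist a b ≤ M) :
    ∃ v ∈ convexHull ℝ {a, b, c}, dist w v ≤ (x + y + z) * M := by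
  have hM : 0 ≤ M := dist_nonneg.trans hM₁
  have hDb : doubleArea b c a = doubleArea a b c := doubleArea_rotate a b c
  have hDc : doubleArea c a b = doubleArea a b c := by rw [doubleArea_rotate, hDb]
  have hxM := mul_nonneg hx hM
  have hyM := mul_nonneg hy hM
  have hzM := mul_nonneg hz hM
  have ratio : ∀ {n r d : ℝ}, 0 ≤ r → -r * doubleArea a b c ≤ n → 0 ≤ d → d ≤ M →
      -n / doubleArea a b c * d ≤ r * M := by
    intro n r d hr hn hd hdM
    exact mul_le_mul ((div_le_iff₀ hD).2 (by linarith)) hdM hd hr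
  rcases le_total (doubleArea b c w) 0 with n₁ | n₁
  · obtain ⟨v, hv, hd⟩ := exists_near_triangle_of_beyond_side hD n₁ h₂.2 h₃.2
    exact ⟨v, hv, by linarith [ratio hx h₁.1 dist_nonneg hM₃]⟩
  rcases le_total (doubleArea c a w) 0 with n₂ | n₂
  · obtain ⟨v, hv, hd⟩ := exists_near_triangle_of_beyond_side (hDb ▸ hD) n₂
      (hDb ▸ h₃.2) (hDb ▸ h₁.2)
    rw [hDb] at hd
    exact ⟨v, convexHull_triple_rotate a b c ▸ hv, by linarith [ratio hy h₂.1 dist_nonneg hM₁]⟩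
  rcases le_total (doubleArea a b w) 0 with n₃ | n₃
  · obtain ⟨v, hv, hd⟩ := exists_near_triangle_of_beyond_side (hDc ▸ hD) n₃
      (hDc ▸ h₁.2) (hDc ▸ h₂.2)
    rw [hDc] at hd
    refine ⟨v, ?_, by linarith [ratio hz h₃.1 dist_nonneg hM₂]⟩
    rwa [← convexHull_triple_rotate a b c, ← convexHull_triple_rotate b c a]
  · refine ⟨w, ?_, by rw [dist_self]; linarith⟩
    refine eq_barycentric hD.ne' w ▸
      mem_convexHull_of_weights (by positivity) (by positivity) (by positivity) ?_
    rw [← add_div, ← add_div, doubleArea_add, div_self hD.ne']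

/-- Barycentric weights at most 1 and summing to 1 are also at least −1. -/
theorem dist_vertex_le {a b c w : Plane} (hD : 0 < doubleArea a b c)
    (h₁ : doubleArea b c w ≤ doubleArea a b c) (h₂ : doubleArea c a w ≤ doubleArea a b c)
    (h₃ : doubleArea a b w ≤ doubleArea a b c) : dist w a ≤ dist a b + dist c a := by
  have hsum := doubleArea_add a b c w
  have e : w - a = (doubleArea c a w / doubleArea a b c) • (b - a) +
      (doubleArea a b w / doubleArea a b c) • (c - a) := by
    have hw := doubleArea_smul_eq a b c w
    have : doubleArea b c w = doubleArea a b c - doubleArea c a w - doubleArea a b w := by linarith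
    rw [this] at hw
    have : w - a = (doubleArea a b c)⁻¹ • (doubleArea a b c • w - doubleArea a b c • a) := by
      rw [← smul_sub, inv_smul_smul₀ hD.ne']
    rw [this, hw]
    module
  have hbd : ∀ {n : ℝ}, -doubleArea a b c ≤ n → n ≤ doubleArea a b c →
      |n / doubleArea a b c| ≤ 1 := by
    intro n h h'
    rw [abs_div, abs_of_pos hD, div_le_one hD]
    exact abs_le.2 ⟨h, h'⟩
  rw [dist_eq_norm, e]
  refine (norm_add_le _ _).trans (add_le_add ?_ ?_)
  · rw [norm_smul, dist_comm, dist_eq_norm, Real.norm_eq_abs]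
    exact mul_le_of_le_one_left (norm_nonneg _) (hbd (by linarith) h₂)
  · rw [norm_smul, dist_eq_norm, Real.norm_eq_abs]
    exact mul_le_of_le_one_left (norm_nonneg _) (hbd (by linarith) h₃)

/-- Heron's formula. -/
theorem heron_doubleArea (a b c : Plane) :
    4 * doubleArea a b c ^ 2 = 2 * (dist b c ^ 2 * dist c a ^ 2 + dist c a ^ 2 * dist a b ^ 2 +
      dist a b ^ 2 * dist b c ^ 2) - (dist b c ^ 4 + dist c a ^ 4 + dist a b ^ 4) := by
  have h4 : ∀ u v : Plane, dist u v ^ 4 = (dist u v ^ 2) ^ 2 := fun u v => by ring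
  rw [h4 b c, h4 c a, h4 a b]
  simp only [dist_eq_norm, plane_norm_sq]
  simp [doubleArea, cross]
  ring

/-- The bound for a body whose deficit is bounded away from zero. -/
theorem hausdorffDist_le_of_vertex {K : Set Plane} {a v : Plane} {ρ : ℝ} (ha : a ∈ K)
    (hK : ∀ w ∈ K, dist w a ≤ ρ) (hv : ‖v‖ ≤ ρ) :
    Metric.hausdorffDist K (eqTriangle a v) ≤ ρ := by
  refine Metric.hausdorffDist_le_of_mem_dist ((norm_nonneg v).trans hv)
    (fun w hw => ⟨a, (mem_convexHull_triple _ _ _).1, hK w hw⟩) fun w hw => ⟨a, ha, ?_⟩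
  have : eqTriangle a v ⊆ Metric.closedBall a ρ := by
    refine convexHull_min ?_ (convex_closedBall a ρ)
    rintro y (rfl | rfl | rfl)
    · simpa using (norm_nonneg v).trans hv
    · simpa using hv
    · simpa [norm_rotSixty] using hv
  exact this hw

/-- The bound for a body close to the triangle `a b c`. -/
theorem hausdorffDist_le_of_triangle {K : Set Plane} (hconv : Convex ℝ K) {a b c v : Plane}
    {ρ σ : ℝ} (ha : a ∈ K) (hb : b ∈ K) (hc : c ∈ K)
    (hK : ∀ w ∈ K, ∃ y ∈ convexHull ℝ {a, b, c}, dist w y ≤ σ)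
    (hbv : dist b (a + v) ≤ ρ) (hcv : dist c (a + rotSixty v) ≤ ρ) :
    Metric.hausdorffDist K (eqTriangle a v) ≤ σ + ρ := by
  have hρ : 0 ≤ ρ := dist_nonneg.trans hbv
  have hσ : 0 ≤ σ := by
    obtain ⟨y, -, h⟩ := hK a ha
    exact dist_nonneg.trans h
  refine Metric.hausdorffDist_le_of_mem_dist (by positivity) (fun w hw => ?_) fun w hw => ?_
  · obtain ⟨y, hy, hwy⟩ := hK w hw
    obtain ⟨y', hy', hyy'⟩ :=
      exists_dist_le_of_mem_convexHull (a' := a) (by simpa using hρ) hbv hcv hy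
    exact ⟨y', hy', (dist_triangle w y y').trans (add_le_add hwy hyy')⟩
  · rw [dist_comm] at hbv hcv
    obtain ⟨y, hy, hwy⟩ :=
      exists_dist_le_of_mem_convexHull (a' := a) (by simpa using hρ) hbv hcv hw
    refine ⟨y, convexHull_min ?_ hconv hy, by linarith⟩
    rintro y (rfl | rfl | rfl) <;> assumption

theorem dist_apex_le {a b c v : Plane} {ρ σ : ℝ} (hρ : 0 ≤ ρ)
    (h : (dist b c ^ 2 + dist c a ^ 2 + dist a b ^ 2) / 2 - √3 * doubleArea a b c ≤ ρ ^ 2)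
    (hv : ‖b - a - v‖ ≤ σ) : dist c (a + rotSixty v) ≤ ρ + σ := by
  have h1 : ‖c - a - rotSixty (b - a)‖ ≤ ρ := by
    refine le_of_sq_le_sq ?_ hρ
    rw [norm_sub_rotSixty_sq, sub_sub_sub_cancel_right]
    rw [dist_eq_norm, dist_eq_norm, dist_eq_norm, norm_sub_rev b c, norm_sub_rev a b,
      doubleArea] at h
    linarith
  have e : c - (a + rotSixty v) = (c - a - rotSixty (b - a)) + rotSixty (b - a - v) := by
    rw [rotSixty_sub (b - a)]
    abel
  rw [dist_eq_norm, e]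
  refine (norm_add_le _ _).trans (add_le_add h1 ?_)
  rwa [norm_rotSixty]

/-! ### The quantitative inequality -/

theorem asymmetry_le_deficit {K : Set Plane} (hconv : Convex ℝ K) (hK : IsCompact K)
    (hint : (interior K).Nonempty) : asymmetry K ≤ 25 * √5 * palDeficit K := by
  have hW := minWidth_pos hK hint
  have hne : K.Nonempty := hint.mono interior_subset
  obtain ⟨a, ha, b, hb, c, hc, hD, x, y, z, hx, hy, hz, hxyz, hmem, hA, h₁, h₂, h₃⟩ :=
    exists_extremal_triangle hconv hK hint
  have hheron := heron_doubleArea a b c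
  obtain ⟨W, hWe⟩ : ∃ W, W = minWidth K := ⟨_, rfl⟩
  obtain ⟨δ, hδe⟩ : ∃ δ, δ = palDeficit K := ⟨_, rfl⟩
  have hareaK : area K = (√3 / 3 + δ) * W ^ 2 := by
    rw [hδe, palDeficit, one_div_sqrt_three, ← hWe]
    rw [← hWe] at hW
    field_simp
    ring
  rw [← hWe] at hW h₁ h₂ h₃
  rw [hareaK] at hA
  -- Area and sides are rescaled to minimal width 1, the normalization of the numerical estimates.
  obtain ⟨Y, hY⟩ : ∃ Y, doubleArea a b c = Y * W ^ 2 :=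
    ⟨doubleArea a b c / W ^ 2, by field_simp⟩
  obtain ⟨b₁, hb₁⟩ : ∃ t, dist b c = t * W := ⟨dist b c / W, by field_simp⟩
  obtain ⟨b₂, hb₂⟩ : ∃ t, dist c a = t * W := ⟨dist c a / W, by field_simp⟩
  obtain ⟨b₃, hb₃⟩ : ∃ t, dist a b = t * W := ⟨dist a b / W, by field_simp⟩
  have hW2 : 0 < W ^ 2 := by positivity
  have hYpos : 0 < Y := by
    rw [hY] at hD
    exact pos_of_mul_pos_left hD hW2.le
  have n₁ : 0 ≤ b₁ := nonneg_of_mul_nonneg_left (hb₁ ▸ dist_nonneg) hW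
  have n₂ : 0 ≤ b₂ := nonneg_of_mul_nonneg_left (hb₂ ▸ dist_nonneg) hW
  have n₃ : 0 ≤ b₃ := nonneg_of_mul_nonneg_left (hb₃ ▸ dist_nonneg) hW
  have heron : 4 * Y ^ 2 = 2 * (b₁ ^ 2 * b₂ ^ 2 + b₂ ^ 2 * b₃ ^ 2 + b₃ ^ 2 * b₁ ^ 2) -
      (b₁ ^ 4 + b₂ ^ 4 + b₃ ^ 4) := by
    rw [hY, hb₁, hb₂, hb₃] at hheron
    have h4 : W ^ 4 ≠ 0 := by positivity
    apply mul_right_cancel₀ h4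
    linear_combination hheron
  have t₁ : b₁ ≤ b₂ + b₃ := by
    have := dist_triangle b a c
    rw [dist_comm b a, dist_comm a c, hb₁, hb₂, hb₃] at this
    exact le_of_mul_le_mul_right (by linarith) hW
  have t₂ : b₂ ≤ b₃ + b₁ := by
    have := dist_triangle c b a
    rw [dist_comm c b, dist_comm b a, hb₁, hb₂, hb₃] at this
    exact le_of_mul_le_mul_right (by linarith) hW
  have t₃ : b₃ ≤ b₁ + b₂ := by
    have := dist_triangle a c b
    rw [dist_comm a c, dist_comm c b, hb₁, hb₂, hb₃] at this
    exact le_of_mul_le_mul_right (by linarith) hW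
  have hiso := triangle_isoperimetric t₁ t₂ t₃ heron
  have k₁ : b₁ ≤ Y * (1 + x) := by
    rw [hb₁, hY] at h₁; exact le_of_mul_le_mul_right (by linarith) hW2
  have k₂ : b₂ ≤ Y * (1 + y) := by
    rw [hb₂, hY] at h₂; exact le_of_mul_le_mul_right (by linarith) hW2
  have k₃ : b₃ ≤ Y * (1 + z) := by
    rw [hb₃, hY] at h₃; exact le_of_mul_le_mul_right (by linarith) hW2
  have kA : Y * (1 + (x + y + z)) / 2 ≤ √3 / 3 + δ := by
    rw [hY] at hA; exact le_of_mul_le_mul_right (by linarith) hW2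
  have hYx := mul_nonneg hYpos.le hx
  have hYy := mul_nonneg hYpos.le hy
  have hYz := mul_nonneg hYpos.le hz
  have hM₁ : dist b c ≤ 2 * (√3 / 3 + δ) * W := by
    rw [hb₁]; exact mul_le_mul_of_nonneg_right (by linarith) hW.le
  have hM₂ : dist c a ≤ 2 * (√3 / 3 + δ) * W := by
    rw [hb₂]; exact mul_le_mul_of_nonneg_right (by linarith) hW.le
  have hM₃ : dist a b ≤ 2 * (√3 / 3 + δ) * W := by
    rw [hb₃]; exact mul_le_mul_of_nonneg_right (by linarith) hW.le
  have hab : 0 < ‖b - a‖ := by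
    rw [norm_pos_iff, sub_ne_zero]
    rintro rfl
    simp [doubleArea, cross] at hD
  set ℓ := 2 * (√3 / 3) * W with hℓ
  have hℓ0 : 0 ≤ ℓ := by positivity
  -- The comparison triangle has vertex `a` and an edge along `a b`, with the length that gives it
  -- the width of K.
  set v : Plane := (ℓ / ‖b - a‖) • (b - a) with hvdef
  have hv : ‖v‖ = ℓ := by
    rw [hvdef, norm_smul, Real.norm_of_nonneg (by positivity), div_mul_cancel₀ _ hab.ne']
  have hasym := asymmetry_le hK hne (hWe ▸ hW) (c := a) (v := v) (hWe ▸ hv)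
  rw [← hWe] at hasym
  rw [← hδe]
  refine hasym.trans ((div_le_iff₀ hW).2 ?_)
  rcases le_or_gt 0.045 δ with hδ | hδ
  · obtain ⟨l₁, l₂⟩ := large_deficit_estimate hδ
    have hℓ4 : ‖v‖ ≤ 4 * (√3 / 3 + δ) * W := by
      rw [hv]; exact mul_le_mul_of_nonneg_right l₁ hW.le
    refine (hausdorffDist_le_of_vertex ha (fun w hw => ?_) hℓ4).trans
      (mul_le_mul_of_nonneg_right l₂ hW.le)
    obtain ⟨m₁, m₂, m₃⟩ := hmem w hw
    linarith [dist_vertex_le hD m₁.2 m₂.2 m₃.2]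
  · obtain ⟨hδ0, hX, hside, hapex⟩ := small_deficit_estimates hYpos hx hy hz rfl hxyz n₁ n₂ n₃
      hiso heron k₁ k₂ k₃ kA hδ
    have hnear : ‖b - a - v‖ ≤ 12.5 * δ * W := by
      have e : b - a - v = (1 - ℓ / ‖b - a‖) • (b - a) := by rw [hvdef, sub_smul, one_smul]
      have e2 : (1 - ℓ / ‖b - a‖) * ‖b - a‖ = (b₃ - 2 * (√3 / 3)) * W := by
        have h3 : ‖b - a‖ = b₃ * W := by rw [← hb₃, dist_comm, dist_eq_norm]
        rw [sub_mul, div_mul_cancel₀ _ hab.ne', h3, hℓ]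
        ring
      rw [e, norm_smul, Real.norm_eq_abs, ← abs_of_pos hab, ← abs_mul, abs_of_pos hab, e2,
        abs_mul, abs_of_pos hW]
      exact mul_le_mul_of_nonneg_right hside hW.le
    have hbv : dist b (a + v) ≤ 25 * δ * W + 12.5 * δ * W := by
      rw [dist_eq_norm, ← sub_sub]
      have : 0 ≤ 25 * δ * W := by positivity
      linarith
    have hcv : dist c (a + rotSixty v) ≤ 25 * δ * W + 12.5 * δ * W := by
      refine dist_apex_le (by positivity) ?_ hnear
      rw [hY, hb₁, hb₂, hb₃]
      have := mul_le_mul_of_nonneg_right hapex hW2.le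
      linarith
    refine (hausdorffDist_le_of_triangle hconv ha hb hc (fun w hw => ?_) hbv hcv).trans
      (?_ : (x + y + z) * (2 * (√3 / 3 + δ) * W) + _ ≤ _)
    · obtain ⟨m₁, m₂, m₃⟩ := hmem w hw
      exact exists_near_triangle hD hx hy hz m₁ m₂ m₃ hM₁ hM₂ hM₃
    · have e1 := mul_le_mul_of_nonneg_right hX hW.le
      have e2 := mul_le_mul_of_nonneg_right lt_sqrt_five.le (mul_nonneg hδ0 hW.le)
      have e3 := mul_nonneg hδ0 hW.le
      linarith

/-! ### Sharpness of the exponent -/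

theorem interior_nonempty_of_volume_pos {K : Set Plane} (hconv : Convex ℝ K)
    (h : 0 < MeasureTheory.volume K) : (interior K).Nonempty := by
  by_contra hempty
  rw [Set.not_nonempty_iff_eq_empty] at hempty
  have hsub : K ⊆ frontier K := by
    rw [frontier, hempty, Set.sdiff_empty]
    exact subset_closure
  have := MeasureTheory.measure_mono (μ := MeasureTheory.volume) hsub
  rw [hconv.addHaar_frontier MeasureTheory.volume] at this
  exact h.not_ge this

/-- The triangle obtained from an equilateral triangle of width one by prolonging a side by
`ε`. -/
noncomputable def stretchedTriangle (ε : ℝ) : Set Plane :=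
  convexHull ℝ {0, !₂[2 * (√3 / 3) + ε, 0], !₂[√3 / 3, 1]}

theorem doubleArea_stretched (ε : ℝ) :
    doubleArea 0 !₂[2 * (√3 / 3) + ε, 0] !₂[√3 / 3, 1] = 2 * (√3 / 3) + ε := by
  simp [doubleArea, cross]

theorem rotSixty_base : rotSixty !₂[2 * (√3 / 3), 0] = !₂[√3 / 3, 1] := by
  have := sqrt_three_sq
  ext i
  fin_cases i
  · simp [rotSixty]
  · simp [rotSixty]; linarith

theorem norm_horizontal {r : ℝ} (hr : 0 ≤ r) : ‖(!₂[r, 0] : Plane)‖ = r := by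
  rw [← sq_eq_sq₀ (norm_nonneg _) hr, plane_norm_sq]
  simp

theorem eqTriangle_base_eq :
    eqTriangle 0 !₂[2 * (√3 / 3), 0] = stretchedTriangle 0 := by
  rw [eqTriangle, rotSixty_base, stretchedTriangle, zero_add, zero_add, add_zero]

theorem isCompact_stretchedTriangle (ε : ℝ) : IsCompact (stretchedTriangle ε) :=
  isCompact_convexHull_triple _ _ _

theorem stretchedTriangle_nonempty (ε : ℝ) : (stretchedTriangle ε).Nonempty :=
  ⟨0, (mem_convexHull_triple _ _ _).1⟩

theorem stretchedTriangle_zero_subset {ε : ℝ} (hε : 0 ≤ ε) :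
    stretchedTriangle 0 ⊆ stretchedTriangle ε := by
  obtain ⟨h0, h1, h2⟩ :=
    mem_convexHull_triple (0 : Plane) !₂[2 * (√3 / 3) + ε, 0] !₂[√3 / 3, 1]
  refine convexHull_min ?_ (convex_convexHull ℝ _)
  rintro y (rfl | rfl | rfl)
  · exact h0
  · have hL : 0 < 2 * (√3 / 3) + ε := by positivity
    refine (convex_convexHull ℝ _).segment_subset h0 h1
      ⟨ε / (2 * (√3 / 3) + ε), 2 * (√3 / 3) / (2 * (√3 / 3) + ε), by positivity, by positivity,
        by field_simp; ring, ?_⟩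
    ext i
    fin_cases i
    · simp; field_simp
    · simp
  · exact h2

theorem interior_stretchedTriangle_nonempty {ε : ℝ} (hε : 0 ≤ ε) :
    (interior (stretchedTriangle ε)).Nonempty := by
  obtain ⟨h0, h1, h2⟩ :=
    mem_convexHull_triple (0 : Plane) !₂[2 * (√3 / 3) + ε, 0] !₂[√3 / 3, 1]
  refine interior_nonempty_of_volume_pos (convex_convexHull ℝ _) (lt_of_lt_of_le ?_
    (MeasureTheory.measure_mono (openTriangle_subset (convex_convexHull ℝ _) h0 h1 h2)))
  rw [volume_openTriangle, doubleArea_stretched]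
  have hL : 0 < 2 * (√3 / 3) + ε := by positivity
  rw [abs_of_pos hL]
  simpa using hL

/-- The altitude over the prolonged side is still 1, and the equilateral triangle of width 1 inside
prevents a smaller width. -/
theorem minWidth_stretchedTriangle {ε : ℝ} (hε : 0 ≤ ε) : minWidth (stretchedTriangle ε) = 1 := by
  have hL : 0 < 2 * (√3 / 3) + ε := by positivity
  refine le_antisymm ?_ (le_minWidth fun u hu => ?_)
  · have h := minWidth_convexHull_triple_le (a := 0) (b := !₂[2 * (√3 / 3) + ε, 0])
      (c := !₂[√3 / 3, 1])
      (by rw [ne_comm, ← norm_pos_iff, norm_horizontal hL.le]; exact hL)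
      (by rw [doubleArea_stretched]; exact hL.le)
    rw [doubleArea_stretched, dist_zero_left, norm_horizontal hL.le] at h
    exact le_of_mul_le_mul_right (by rw [one_mul]; exact h) hL
  · have h := le_directionalWidth_of_eqTriangle_subset (isCompact_stretchedTriangle ε)
      (eqTriangle_base_eq ▸ stretchedTriangle_zero_subset hε) hu
    rw [norm_horizontal (by positivity)] at h
    linarith [sqrt_three_sq]

theorem palDeficit_stretchedTriangle_le {ε : ℝ} (hε : 0 ≤ ε) :
    palDeficit (stretchedTriangle ε) ≤ ε / 2 := by
  have hL : 0 < 2 * (√3 / 3) + ε := by positivity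
  have h := ENNReal.toReal_mono ENNReal.ofReal_ne_top (volume_convexHull_triangle_le 0
    !₂[2 * (√3 / 3) + ε, 0] !₂[√3 / 3, 1])
  rw [doubleArea_stretched, abs_of_pos hL, ENNReal.toReal_ofReal (by positivity)] at h
  rw [palDeficit, minWidth_stretchedTriangle hε, one_div_sqrt_three, one_pow, div_one]
  change area (stretchedTriangle ε) ≤ _ at h
  linarith

theorem dist_le_of_mem_eqTriangle {c v x y : Plane} (hx : x ∈ eqTriangle c v)
    (hy : y ∈ eqTriangle c v) : dist x y ≤ ‖v‖ := by
  obtain ⟨x', hx', y', hy', h⟩ := convexHull_exists_dist_ge2 hx hy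
  refine h.trans ?_
  rcases hx' with rfl | rfl | rfl <;> rcases hy' with rfl | rfl | rfl <;>
    simp [dist_eq_norm, norm_rotSixty, norm_rotSixty_sub, norm_sub_rev v]

/-- The long side exceeds the diameter of every competing triangle by ε, so one of its endpoints is
at distance at least ε/2 from that triangle. -/
theorem le_asymmetry_stretchedTriangle {ε : ℝ} (hε : 0 ≤ ε) :
    ε / 2 ≤ asymmetry (stretchedTriangle ε) := by
  have hW := minWidth_stretchedTriangle hε
  have hK := isCompact_stretchedTriangle ε
  have hne := stretchedTriangle_nonempty ε
  obtain ⟨c, v, hv, h⟩ := (mem_asymmetryValues_iff (hW ▸ zero_lt_one)).1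
    (isLeast_asymmetry hK hne (hW ▸ zero_lt_one)).1
  rw [hW, mul_one] at hv
  rw [h, hW, div_one]
  have hfin : Metric.hausdorffEDist (stretchedTriangle ε) (eqTriangle c v) ≠ ⊤ :=
    Metric.hausdorffEDist_ne_top_of_nonempty_of_bounded hne (eqTriangle_nonempty _ _)
      hK.isBounded (isCompact_eqTriangle _ _).isBounded
  obtain ⟨h0, h1, -⟩ :=
    mem_convexHull_triple (0 : Plane) !₂[2 * (√3 / 3) + ε, 0] !₂[√3 / 3, 1]
  obtain ⟨p, hp, hpd⟩ := (isCompact_eqTriangle c v).exists_infDist_eq_dist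
    (eqTriangle_nonempty c v) 0
  obtain ⟨q, hq, hqd⟩ := (isCompact_eqTriangle c v).exists_infDist_eq_dist
    (eqTriangle_nonempty c v) !₂[2 * (√3 / 3) + ε, 0]
  have hp' := hpd ▸ Metric.infDist_le_hausdorffDist_of_mem h0 hfin
  have hq' := hqd ▸ Metric.infDist_le_hausdorffDist_of_mem h1 hfin
  have hpq := dist_le_of_mem_eqTriangle hp hq
  have htri := dist_triangle4 0 p q !₂[2 * (√3 / 3) + ε, 0]
  rw [dist_zero_left, norm_horizontal (by positivity), dist_comm q] at htri
  change _ ≤ Metric.hausdorffDist (stretchedTriangle ε) _ at hp' hq'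
  linarith

theorem asymmetry_stretchedTriangle_le {ε : ℝ} (hε : 0 ≤ ε) :
    asymmetry (stretchedTriangle ε) ≤ ε := by
  have hW := minWidth_stretchedTriangle hε
  have h := asymmetry_le (isCompact_stretchedTriangle ε) (stretchedTriangle_nonempty ε)
    (hW ▸ zero_lt_one) (c := 0) (v := !₂[2 * (√3 / 3), 0])
    (by rw [hW, mul_one, norm_horizontal (by positivity)])
  rw [hW, div_one, eqTriangle_base_eq] at h
  refine h.trans (Metric.hausdorffDist_le_of_mem_dist hε (fun x hx => ?_) fun x hx =>
    ⟨x, stretchedTriangle_zero_subset hε hx, by simpa using hε⟩)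
  refine exists_dist_le_of_mem_convexHull (by simpa using hε) ?_ (by simpa using hε) hx
  have e : (!₂[2 * (√3 / 3) + ε, 0] : Plane) - !₂[2 * (√3 / 3) + 0, 0] = !₂[ε, 0] := by
    ext i; fin_cases i <;> simp
  rw [dist_eq_norm, e, norm_horizontal hε]

theorem exists_small_lt_mul_rpow {t c : ℝ} (ht : t < 1) (hc : 0 < c) :
    ∃ e : ℝ, 0 < e ∧ e ≤ 1 / 2 ∧ ∀ α, e ≤ α → α ≤ 1 → e < c * α ^ t := by
  -- Replacing t by max(t, 0) covers negative exponents: α ≤ 1 gives αˢ ≤ αᵗ, and s ≥ 0 gives eˢ ≤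
  -- αˢ.
  set s := max t 0
  have hs : 0 < 1 - s := sub_pos.2 (max_lt ht zero_lt_one)
  have hc2 : 0 < c / 2 := half_pos hc
  set e := min (1 / 2) ((c / 2) ^ (1 / (1 - s)))
  have he0 : 0 < e := lt_min (by norm_num) (Real.rpow_pos_of_pos hc2 _)
  refine ⟨e, he0, min_le_left _ _, fun α hα hα1 => ?_⟩
  have h1 : e ^ (1 - s) ≤ c / 2 := by
    calc e ^ (1 - s) ≤ ((c / 2) ^ (1 / (1 - s))) ^ (1 - s) :=
          Real.rpow_le_rpow he0.le (min_le_right _ _) hs.le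
      _ = c / 2 := by rw [← Real.rpow_mul hc2.le, one_div_mul_cancel hs.ne', Real.rpow_one]
  have h2 : e ^ s ≤ α ^ t :=
    (Real.rpow_le_rpow he0.le hα (le_max_right _ _)).trans
      (Real.rpow_le_rpow_of_exponent_ge (he0.trans_le hα) hα1 (le_max_left _ _))
  have hes : 0 < e ^ s := Real.rpow_pos_of_pos he0 s
  calc e = e ^ (1 - s) * e ^ s := by rw [← Real.rpow_add he0, sub_add_cancel, Real.rpow_one]
    _ ≤ c / 2 * e ^ s := mul_le_mul_of_nonneg_right h1 hes.le
    _ < c * e ^ s := mul_lt_mul_of_pos_right (half_lt_self hc) hes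
    _ ≤ c * α ^ t := mul_le_mul_of_nonneg_left h2 hc.le

theorem theorem2 :
    -- the quantitative inequality, with the minimum defining the asymmetry attained
    (∀ K : ConvexBody Plane, (interior (K : Set Plane)).Nonempty →
      IsLeast (asymmetryValues (K : Set Plane)) (asymmetry (K : Set Plane)) ∧
      palDeficit (K : Set Plane) ≥ 1 / (25 * √5) * asymmetry (K : Set Plane)) ∧
    -- the exponent 1 cannot be lowered, whatever the constant
    (∀ t : ℝ, t < 1 → ∀ c : ℝ, 0 < c →
      ∃ K : ConvexBody Plane, (interior (K : Set Plane)).Nonempty ∧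
        0 < asymmetry (K : Set Plane) ∧
        palDeficit (K : Set Plane) < c * asymmetry (K : Set Plane) ^ t) := by
  refine ⟨fun K hint => ⟨isLeast_asymmetry K.isCompact K.nonempty (minWidth_pos K.isCompact hint),
    ?_⟩, fun t ht c hc => ?_⟩
  · rw [ge_iff_le, one_div_mul_eq_div, div_le_iff₀' (by positivity)]
    exact asymmetry_le_deficit K.convex K.isCompact hint
  · obtain ⟨e, he0, he, hlt⟩ := exists_small_lt_mul_rpow ht hc
    -- With ε = 2e the deficit is at most e, while e ≤ α ≤ 2e ≤ 1.
    have hε : 0 ≤ 2 * e := by positivity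
    have hlow := le_asymmetry_stretchedTriangle hε
    have hup := asymmetry_stretchedTriangle_le hε
    have hdef := palDeficit_stretchedTriangle_le hε
    refine ⟨⟨stretchedTriangle (2 * e), convex_convexHull ℝ _, isCompact_stretchedTriangle _,
      stretchedTriangle_nonempty _⟩, interior_stretchedTriangle_nonempty hε, ?_, ?_⟩
    · change 0 < asymmetry (stretchedTriangle (2 * e))
      linarith
    · change palDeficit (stretchedTriangle (2 * e)) < c * asymmetry (stretchedTriangle (2 * e)) ^ t
      have := hlt (asymmetry (stretchedTriangle (2 * e))) (by linarith) (by linarith)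
      linarith
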